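/- **Signal.** For $K\ge 1$ let $f(u)=\sum_{j=1}^K A_j(u)e^{i\phi_j(u)}$, with $A_j:\mathbb R\to\mathbb C$ continuous and $\phi_j:\mathbb R\to\mathbb R$ continuously differentiable. Fix $t\in\mathbb R$ and put $$B=\max_{1\le j\le K}|\phi_j'(t)|,\quad M=\sum_{j=1}^K|A_j(t)|,\quad \mu=\min_{1\le j\le K}|A_j(t)|>0 .$$ Assume $\phi_j'(t)>0$ for $j=1,\dots,K$ and, with $\phi_0'(t):=0$, let $$\min_{0\le j\ne\ell\le K}|\phi_j'(t)-\phi_\ell'(t)|=4B\eta>0 .$$ Let $\alpha>0$ be such that for all $j$ and all $|u|\le\alpha^{-1}(8\pi B)^{-1/2}$ $$|A_j(t+u)-A_j(t)|\le\alpha^3|u||A_j(t)|,\qquad |\phi_j'(t+u)-\phi_j'(t)|\le\alpha^3|u||\phi_j'(t)|.$$ **Operator.** Let $h\in C^3(\mathbb R)$ be even, nonnegative, not identically $0$, with support in $[-1,1]$. Put $\hbar_n=\sum_{j\in\mathbb Z}h(j/n)$, $\Phi_n(u)=\sum_{k\in\mathbb Z}h(k/n)e^{iku}$ and $$\mathcal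 T_{n,\delta}(G)(u,\theta)=\frac1{\hbar_n}\sum_{j\in\mathbb Z}h\left(\frac jn\right)e^{ij\theta}G(u-j\delta).$$ Let $0<\delta\le 1/(4B)$, let $n$ be the smallest integer with $n\ge(\alpha\delta\sqrt{8\pi B})^{-1}$, and put $\omega_\ell^*=\delta\phi_\ell'(t)$, $f_\ell^*=A_\ell(t)e^{i\phi_\ell(t)}$. **Interpolant.** Let $m\ge1$, $L\ge1$, $0\le r<m$, let $a=t_0<t_1<\dots<t_{Lm+r}=b$, and let $\Delta=\max_{0\le k<Lm+r}(t_{k+1}-t_k)$. Let $\rho\ge1$ be a bound for the ratio of the lengths of any two neighbouring intervals $[t_k,t_{k+1}]$. For $0\le j\le L-1$ let $R_j(g)$ be the polynomial of degree $<m$ that interpolates $g$ at $t_{jm+1},\dots,t_{(j+1)m}$. Let $Q(g)=R_j(g)$ on $(t_{jm},t_{(j+1)m}]$, where the first of these intervals also contains $t_0$ and the last one is extended to the right up to $b$, and let $Q(g)=0$ outside $[a,b]$. **Theorem 3.1.** There are a constant $c>0$ depending only on $m$ and a constant $C>0$ depending only on $m$ and $\rho$ such that the following holds for every $E>0$. Let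 $f$ be $m$ times continuously differentiable on $[a,b]$ and $0$ outside $[a,b]$, and let $F=f+\epsilon$, where $\epsilon:\mathbb R\to\mathbb C$ satisfies $$c\,\Delta^m\max_{s\in[a,b]}|f^{(m)}(s)|+|\epsilon(u)|\le E\alpha,\qquad u\in\mathbb R .$$ There are $\alpha_0>0$ and $\gamma>0$, depending only on $m,\rho,h,E,M,\mu,B,\eta$, such that if $\alpha\le\alpha_0$, then $\hbar_n>0$ and, with $T(\theta)=\mathcal T_{n,\delta}(Q(F))(t,\theta)$: (a) The set $\{\theta\in[0,\pi]:|T(\theta)|\ge\mu/2\}$ is a disjoint union of exactly $K$ non-empty sets $\mathcal G_1,\dots,\mathcal G_K$ such that $\omega_\ell^*$ is the only one of $\omega_1^*,\dots,\omega_K^*$ in $\mathcal G_\ell$, $\operatorname{diam}(\mathcal G_\ell)\le B\eta\delta$, and $\operatorname{dist}(\mathcal G_\ell,\mathcal G_j)\ge B\eta\delta$ for $\ell\ne j$. (b) $|T|$ attains its maximum on every $\mathcal G_\ell$, and every maximizer $\widehat\omega_\ell$ satisfies $|\widehat\omega_\ell-\omega_\ell^*|\le\gamma\alpha\delta$. (c)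 If $\Phi_n$ is real and nonnegative, then for every maximizer $\widehat\omega_\ell$ $$\bigl||T(\widehat\omega_\ell)|-|A_\ell(t)|\bigr|\le 2(2M+CE)\alpha,\qquad |T(\widehat\omega_\ell)-f_\ell^*|\le 2\left(1+\frac{5M}{\mu}\right)(2M+CE)\alpha .$$ -/

import Mathlib

open Set

noncomputable section

namespace SSO

/-! ### The signal model -/

/-- The signal `f(u) = ∑ⱼ Aⱼ(u) exp(i φⱼ(u))`. -/
def signal {K : ℕ} (A : Fin K → ℝ → ℂ) (φ : Fin K → ℝ → ℝ) (u : ℝ) : ℂ :=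
  ∑ j, A j u * Complex.exp (Complex.I * (φ j u : ℂ))

/-- `B(t) = maxⱼ |φⱼ'(t)|` (used for `K ≥ 1`). -/
def maxFreq {K : ℕ} (φ : Fin K → ℝ → ℝ) (t : ℝ) : ℝ := ⨆ j, |deriv (φ j) t|

/-- `M(t) = ∑ⱼ |Aⱼ(t)|`. -/
def totalAmp {K : ℕ} (A : Fin K → ℝ → ℂ) (t : ℝ) : ℝ := ∑ j, ‖A j t‖

/-- `μ(t) = minⱼ |Aⱼ(t)|` (used for `K ≥ 1`). -/
def minAmp {K : ℕ} (A : Fin K → ℝ → ℂ) (t : ℝ) : ℝ := ⨅ j, ‖A j t‖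

/-- The frequencies `φ₀'(t) := 0, φ₁'(t), …, φ_K'(t)`. -/
def extFreq {K : ℕ} (φ : Fin K → ℝ → ℝ) (t : ℝ) : Fin (K + 1) → ℝ :=
  Fin.cons 0 (fun j => deriv (φ j) t)

/-- The minimal separation `min_{0 ≤ j ≠ ℓ ≤ K} |φⱼ'(t) - φ_ℓ'(t)|`, where `φ₀'(t) = 0`
(used for `K ≥ 1`). -/
def freqGap {K : ℕ} (φ : Fin K → ℝ → ℝ) (t : ℝ) : ℝ :=
  ⨅ p : {p : Fin (K + 1) × Fin (K + 1) // p.1 ≠ p.2},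
    |extFreq φ t p.1.1 - extFreq φ t p.1.2|

/-- The class `𝓗(t)` with the parameter `α = α(t)` displayed. -/
structure InClass {K : ℕ} (A : Fin K → ℝ → ℂ) (φ : Fin K → ℝ → ℝ) (t α : ℝ) : Prop where
  continuous_amp : ∀ j, Continuous (A j)
  contDiff_phase : ∀ j, ContDiff ℝ 1 (φ j)
  amp_slow : ∀ (j : Fin K) (u : ℝ), |u| ≤ α⁻¹ * (√(8 * Real.pi * maxFreq φ t))⁻¹ →
    ‖A j (t + u) - A j t‖ ≤ α ^ 3 * |u| * ‖A j t‖
  freq_slow : ∀ (j : Fin K) (u : ℝ), |u| ≤ α⁻¹ * (√(8 * Real.pi * maxFreq φ t))⁻¹ →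
    |deriv (φ j) (t + u) - deriv (φ j) t| ≤ α ^ 3 * |u| * |deriv (φ j) t|

/-! ### The signal separation operator -/

/-- Admissible window functions. -/
structure IsAdmissibleWindow (h : ℝ → ℝ) : Prop where
  nonneg : ∀ u, 0 ≤ h u
  contDiff : ContDiff ℝ 3 h
  even : ∀ u, h (-u) = h u
  support_subset : Function.support h ⊆ Icc (-1) 1
  pos : ∃ u, 0 < h u

/-- `ħₙ = ∑_{j ∈ ℤ} h(j/n)`; for an admissible `h` and `n ≥ 1` the sum has finitely many
nonzero terms. -/
def hbar (h : ℝ → ℝ) (n : ℕ) : ℝ := ∑' j : ℤ, h (j / n)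

/-- `Φₙ(u) = ∑_{k ∈ ℤ} h(k/n) exp(iku)`. -/
def kernelPhi (h : ℝ → ℝ) (n : ℕ) (u : ℝ) : ℂ :=
  ∑' k : ℤ, (h (k / n) : ℂ) * Complex.exp (Complex.I * k * u)

/-- The signal separation operator
`𝓣_{n,δ}(F)(u,θ) = (1/ħₙ) ∑_{j ∈ ℤ} h(j/n) exp(ijθ) F(u - jδ)`. -/
def sso (h : ℝ → ℝ) (n : ℕ) (δ : ℝ) (F : ℝ → ℂ) (u θ : ℝ) : ℂ :=
  (1 / (hbar h n : ℂ)) *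
    ∑' j : ℤ, (h (j / n) : ℂ) * Complex.exp (Complex.I * j * θ) * F (u - j * δ)

/-! ### Piecewise polynomial interpolation at nodes `x₀ < x₁ < ⋯ < x_N`, `N = L m + r` -/

/-- Only the values `x 0, …, x N` of the sequence matter. -/
def IsNodeSeq (a b : ℝ) (N : ℕ) (x : ℕ → ℝ) : Prop :=
  x 0 = a ∧ x N = b ∧ ∀ k < N, x k < x (k + 1)

/-- The mesh norm: the largest gap `x_{k+1} - x_k`, `0 ≤ k < N`. -/
def meshNorm (N : ℕ) (x : ℕ → ℝ) : ℝ := ⨆ k : Fin N, (x (k + 1) - x k)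

/-- The ratio of the lengths of any two neighbouring gaps is at most `ρ`. -/
def MeshRatioLe (ρ : ℝ) (N : ℕ) (x : ℕ → ℝ) : Prop :=
  ∀ k, k + 2 ≤ N → x (k + 2) - x (k + 1) ≤ ρ * (x (k + 1) - x k) ∧
    x (k + 1) - x k ≤ ρ * (x (k + 2) - x (k + 1))

/-- `R_j(g)`: the polynomial of degree `< m` that interpolates `g` at
`x_{jm+1}, …, x_{(j+1)m}`. -/
def blockPoly (m : ℕ) (x : ℕ → ℝ) (g : ℝ → ℂ) (j : ℕ) : Polynomial ℂ :=
  Lagrange.interpolate (Finset.range m) (fun i => ((x (j * m + 1 + i) : ℝ) : ℂ))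
    (fun i => g (x (j * m + 1 + i)))

/-- The `j`-th piece of `[x₀, x_N]`: `(x_{jm}, x_{(j+1)m}]`, except that the first piece also
contains its left end point `x₀` and that the last piece (`j = L - 1`) reaches to `x_N`. -/
def piece (m L r : ℕ) (x : ℕ → ℝ) (j : ℕ) : Set ℝ :=
  let right := if j + 1 = L then x (L * m + r) else x ((j + 1) * m)
  if j = 0 then Icc (x 0) right else Ioc (x (j * m)) right

/-- `Q(g)`, equal to `R_j(g)` on the `j`-th piece and to `0` outside `[x₀, x_N]`
(the pieces are disjoint). -/
def interpQ (m L r : ℕ) (x : ℕ → ℝ) (g : ℝ → ℂ) (u : ℝ) : ℂ :=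
  ∑ j ∈ Finset.range L,
    (piece m L r x j).indicator (fun v => (blockPoly m x g j).eval (v : ℂ)) u

/-- `max_{s ∈ [a,b]} |f^{(m)}(s)|`. -/
def maxDeriv (m : ℕ) (a b : ℝ) (f : ℝ → ℂ) : ℝ :=
  sSup ((fun s => ‖iteratedDerivWithin m f (Icc a b) s‖) '' Icc a b)

end SSO

end

namespace SSO

/-! ### Geometry of the nodes -/

/-! Write `q = √(8πB)`. The window weighs only samples at `t - jδ` with `|j| < n`, and minimality of
`n` puts these within `1/(αq)` of `t`. There the signal is, up to `Mα`, the exponential sum with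
amplitudes and frequencies frozen at `t` (`InClass.norm_signal_sub_le`), and interpolation of noisy
data costs `CEα` (`norm_interpQ_sub_le`). The operator is an average with unimodular phases, so it
does not amplify errors. It turns the frozen sum into `∑ f_ℓ^* p(θ - ω_ℓ^*)` with the bump `p =
Φₙ/ħₙ`.

The bump is `1` at `0`, at most `1` in modulus, and `O((nu)⁻²)` on `[-π, π]`: two summations by
parts move second differences onto `h`, each `O(n⁻²)`, while `ħₙ` grows linearly
(`IsAdmissibleWindow.exists_norm_kernelPhi_le`). As `n ≥ 1/(αδq)`, for small `α` the bump is at most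
`α` outside radius `σ = Bηδ/2`, so foreign bumps cost at most another `Mα`.

Put `e = (2M + CE)α`. Then `T` is within `e` of a single bump near each centre and at most `e` far
from all centres. If `4e ≤ μ`, the level `μ/2` isolates the clusters, which gives (a). At a
maximizer the bump is at least `1/2`, and its decay then confines the maximizer to `O(1/n)`, that is
`O(αδ)`, around the centre, which gives (b). Comparing `T` with the single bump there gives (c).
`BumpSum` isolates this last argument. -/

lemma IsNodeSeq.lt {a b : ℝ} {N : ℕ} {x : ℕ → ℝ} (hx : IsNodeSeq a b N x) {i k : ℕ}
    (hik : i < k) (hk : k ≤ N) : x i < x k := by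
  induction k, hik using Nat.le_induction with
  | base => exact hx.2.2 i hk
  | succ k hik ih => exact (ih (by omega)).trans (hx.2.2 k hk)

lemma IsNodeSeq.le {a b : ℝ} {N : ℕ} {x : ℕ → ℝ} (hx : IsNodeSeq a b N x) {i k : ℕ}
    (hik : i ≤ k) (hk : k ≤ N) : x i ≤ x k := by
  rcases hik.eq_or_lt with rfl | h
  · exact le_rfl
  · exact (hx.lt h hk).le

/-- The neighbour ratio compounds along the chain. `d` is only an upper bound for the index
distance, so that later estimates share one exponent. -/
lemma MeshRatioLe.gap_le {ρ a b : ℝ} (hρ : 1 ≤ ρ) {N : ℕ} {x : ℕ → ℝ}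
    (hr : MeshRatioLe ρ N x) (hx : IsNodeSeq a b N x) {i k d : ℕ} (hik : i ≤ k) (hk : k < N)
    (hd : k ≤ i + d) :
    x (k + 1) - x k ≤ ρ ^ d * (x (i + 1) - x i) ∧ x (i + 1) - x i ≤ ρ ^ d * (x (k + 1) - x k) := by
  have hρ0 : 0 ≤ ρ := zero_le_one.trans hρ
  have key : x (k + 1) - x k ≤ ρ ^ (k - i) * (x (i + 1) - x i) ∧
      x (i + 1) - x i ≤ ρ ^ (k - i) * (x (k + 1) - x k) := by
    clear hd
    induction k, hik using Nat.le_induction with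
    | base => simp
    | succ k hik ih =>
      obtain ⟨h1, h2⟩ := ih (by omega)
      obtain ⟨h3, h4⟩ := hr k (by omega)
      have e : k + 1 - i = (k - i) + 1 := by omega
      rw [e, pow_succ]
      refine ⟨h3.trans ?_, h2.trans ?_⟩
      · calc ρ * (x (k + 1) - x k) ≤ ρ * (ρ ^ (k - i) * (x (i + 1) - x i)) := by gcongr
          _ = _ := by ring
      · calc ρ ^ (k - i) * (x (k + 1) - x k) ≤ ρ ^ (k - i) * (ρ * (x (k + 2) - x (k + 1))) := by
              gcongr
          _ = _ := by ring
  have hp : ρ ^ (k - i) ≤ ρ ^ d := pow_le_pow_right₀ hρ (by omega)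
  have hgi := hx.2.2 i (by omega)
  have hgk := hx.2.2 k hk
  exact ⟨key.1.trans (mul_le_mul_of_nonneg_right hp (by linarith)),
    key.2.trans (mul_le_mul_of_nonneg_right hp (by linarith))⟩

lemma sub_le_mul_of_gap_le {x : ℕ → ℝ} {G : ℝ} {i k : ℕ} (hik : i ≤ k)
    (hG : ∀ l, i ≤ l → l < k → x (l + 1) - x l ≤ G) : x k - x i ≤ (k - i : ℕ) * G := by
  induction k, hik using Nat.le_induction with
  | base => simp
  | succ k hik ih =>
    have h1 := ih fun l h h' => hG l h (by omega)
    have h2 := hG k hik (by omega)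
    have e : k + 1 - i = (k - i) + 1 := by omega
    rw [e]; push_cast; linarith

lemma gap_le_meshNorm {N : ℕ} (x : ℕ → ℝ) {k : ℕ} (hk : k < N) :
    x (k + 1) - x k ≤ meshNorm N x :=
  le_ciSup (f := fun k : Fin N => x (k + 1) - x k) (Set.finite_range _).bddAbove ⟨k, hk⟩

lemma mem_piece_iff {m L r : ℕ} {x : ℕ → ℝ} {j : ℕ} {u : ℝ} :
    u ∈ piece m L r x j ↔ (j = 0 → x 0 ≤ u) ∧ (j ≠ 0 → x (j * m) < u) ∧
      (j + 1 = L → u ≤ x (L * m + r)) ∧ (j + 1 ≠ L → u ≤ x ((j + 1) * m)) := by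
  unfold piece
  by_cases h0 : j = 0 <;> by_cases h1 : j + 1 = L <;> simp [h0, h1] <;> grind

lemma exists_mem_piece {m L r : ℕ} {x : ℕ → ℝ} (hL : 1 ≤ L) {u : ℝ} (h0 : x 0 ≤ u)
    (h1 : u ≤ x (L * m + r)) : ∃ j < L, u ∈ piece m L r x j := by
  classical
  -- Take the least such index: its predecessor fails, which is the strict inequality at the left
  -- end.
  have hex : ∃ j, j + 1 = L ∨ u ≤ x ((j + 1) * m) := ⟨L - 1, Or.inl (by omega)⟩
  refine ⟨Nat.find hex, ?_, ?_⟩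
  · have := Nat.find_min' hex (m := L - 1) (Or.inl (by omega))
    omega
  · rw [mem_piece_iff]
    refine ⟨fun _ => h0, fun hj => ?_, fun _ => h1, fun hj => ?_⟩
    · have h := Nat.find_min hex (m := Nat.find hex - 1) (by omega)
      push Not at h
      have e : Nat.find hex - 1 + 1 = Nat.find hex := by omega
      rw [e] at h
      exact h.2
    · exact (Nat.find_spec hex).resolve_left hj

lemma piece_disjoint {a b : ℝ} {m L r : ℕ} {x : ℕ → ℝ} (hx : IsNodeSeq a b (L * m + r) x)
    {j k : ℕ} (hjk : j < k) (hk : k < L) {u : ℝ} (hj : u ∈ piece m L r x j) :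
    u ∉ piece m L r x k := by
  intro hu
  have h1 := (mem_piece_iff.1 hj).2.2.2 (by omega)
  have h2 := (mem_piece_iff.1 hu).2.1 (by omega)
  have h3 : x ((j + 1) * m) ≤ x (k * m) := by
    refine hx.le (Nat.mul_le_mul_right _ hjk) ?_
    have := Nat.mul_le_mul_right m hk.le
    omega
  linarith

lemma interpQ_of_mem {a b : ℝ} {m L r : ℕ} {x : ℕ → ℝ} (hx : IsNodeSeq a b (L * m + r) x)
    (g : ℝ → ℂ) {j : ℕ} (hj : j < L) {u : ℝ} (hu : u ∈ piece m L r x j) :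
    interpQ m L r x g u = (blockPoly m x g j).eval (u : ℂ) := by
  unfold interpQ
  rw [Finset.sum_eq_single_of_mem j (Finset.mem_range.2 hj)]
  · rw [indicator_of_mem hu]
  · intro k hk hkj
    rw [Finset.mem_range] at hk
    apply indicator_of_notMem
    rcases lt_or_gt_of_ne hkj with h | h
    · exact fun h' => piece_disjoint hx h hj h' hu
    · exact piece_disjoint hx h hk hu

lemma interpQ_of_notMem {a b : ℝ} {m L r : ℕ} {x : ℕ → ℝ} (hx : IsNodeSeq a b (L * m + r) x)
    (g : ℝ → ℂ) {u : ℝ} (hu : u ∉ Icc a b) : interpQ m L r x g u = 0 := by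
  unfold interpQ
  refine Finset.sum_eq_zero fun j hj => indicator_of_notMem (fun h => hu ?_) _
  rw [Finset.mem_range] at hj
  obtain ⟨h1, h2, h3, h4⟩ := mem_piece_iff.1 h
  have hjm : (j + 1) * m ≤ L * m := Nat.mul_le_mul_right m hj
  have hjm' : j * m ≤ L * m := Nat.mul_le_mul_right m hj.le
  rw [← hx.1, ← hx.2.1]
  constructor
  · by_cases h0 : j = 0
    · exact h1 h0
    · exact (hx.le (Nat.zero_le _) (by omega)).trans (h2 h0).le
  · by_cases h0 : j + 1 = L
    · exact h3 h0
    · exact (h4 h0).trans (hx.le (by omega) le_rfl)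

/-! ### Interpolation error -/

/-- Each Lagrange basis polynomial is a product of `m - 1` factors of modulus at most `W`; `1 ≤ W`
allows the rounder exponent `m`. -/
lemma norm_eval_interpolate_le {m : ℕ} {y : ℕ → ℝ} {v : ℕ → ℂ} {u W V : ℝ} (hW : 1 ≤ W)
    (hy : ∀ i < m, ∀ k < m, i ≠ k → |u - y k| ≤ W * |y i - y k|)
    (hv : ∀ i < m, ‖v i‖ ≤ V) :
    ‖(Lagrange.interpolate (Finset.range m) (fun i => ((y i : ℝ) : ℂ)) v).eval (u : ℂ)‖
      ≤ m * W ^ m * V := by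
  rw [Lagrange.interpolate_apply, Polynomial.eval_finsetSum]
  refine (norm_sum_le _ _).trans ?_
  have : ∀ i ∈ Finset.range m, ‖(Polynomial.C (v i) * Lagrange.basis (Finset.range m)
      (fun i => ((y i : ℝ) : ℂ)) i).eval (u : ℂ)‖ ≤ W ^ m * V := by
    intro i hi
    rw [Polynomial.eval_mul, Polynomial.eval_C, norm_mul, mul_comm]
    have hV : 0 ≤ V := (norm_nonneg _).trans (hv i (Finset.mem_range.1 hi))
    refine mul_le_mul ?_ (hv i (Finset.mem_range.1 hi)) (norm_nonneg _) (by positivity)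
    rw [Lagrange.basis, Polynomial.eval_prod, norm_prod]
    refine (Finset.prod_le_prod (g := fun _ => W) (fun _ _ => norm_nonneg _)
      fun k hk => ?_).trans ((Finset.prod_const W).le.trans
        (pow_le_pow_right₀ hW ((Finset.card_erase_le).trans (by simp))))
    rw [Finset.mem_erase, Finset.mem_range] at hk
    have h := hy i (Finset.mem_range.1 hi) k hk.2 hk.1.symm
    simp only [Lagrange.basisDivisor, Polynomial.eval_mul, Polynomial.eval_C, Polynomial.eval_sub,
      Polynomial.eval_X, norm_mul, norm_inv]
    rw [← Complex.ofReal_sub, ← Complex.ofReal_sub, Complex.norm_real, Complex.norm_real,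
      Real.norm_eq_abs, Real.norm_eq_abs, inv_mul_eq_div]
    exact div_le_of_le_mul₀ (abs_nonneg _) (by linarith) h
  refine (Finset.sum_le_card_nsmul _ _ _ this).trans (le_of_eq ?_)
  simp [mul_assoc]

lemma norm_iteratedDerivWithin_le_maxDeriv {m : ℕ} {a b : ℝ} (hab : a < b) {f : ℝ → ℂ}
    (hf : ContDiffOn ℝ m f (Icc a b)) {s : ℝ} (hs : s ∈ Icc a b) :
    ‖iteratedDerivWithin m f (Icc a b) s‖ ≤ maxDeriv m a b f := by
  refine le_csSup ?_ (mem_image_of_mem _ hs)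
  exact (isCompact_Icc.image_of_continuousOn
    (hf.continuousOn_iteratedDerivWithin le_rfl (uniqueDiffOn_Icc hab)).norm).bddAbove

lemma exists_taylor_polynomial {m : ℕ} (hm : 1 ≤ m) {a b p : ℝ} (hap : a ≤ p) (hpb : p < b)
    {f : ℝ → ℂ} (hf : ContDiffOn ℝ m f (Icc a b)) :
    ∃ P : Polynomial ℂ, P.degree < m ∧ ∀ s ∈ Icc p b,
      ‖f s - P.eval (s : ℂ)‖ ≤ maxDeriv m a b f * (s - p) ^ m := by
  obtain ⟨n, rfl⟩ : ∃ n, m = n + 1 := ⟨m - 1, by omega⟩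
  have hsub : Icc p b ⊆ Icc a b := Icc_subset_Icc_left hap
  refine ⟨∑ k ∈ Finset.range (n + 1),
    Polynomial.C (((k.factorial : ℝ)⁻¹ : ℝ) * iteratedDerivWithin k f (Icc p b) p : ℂ) *
      (Polynomial.X - Polynomial.C (p : ℂ)) ^ k, ?_, fun s hs => ?_⟩
  · refine (Polynomial.degree_sum_le _ _).trans_lt ?_
    rw [Finset.sup_lt_iff (by exact WithBot.bot_lt_coe _)]
    intro k hk
    rw [Finset.mem_range] at hk
    rw [← Polynomial.smul_eq_C_mul]
    refine (Polynomial.degree_smul_le _ _).trans_lt ?_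
    rw [Polynomial.degree_pow, Polynomial.degree_X_sub_C, nsmul_one]
    exact_mod_cast hk
  · have h0 : 0 ≤ maxDeriv (n + 1) a b f :=
      (norm_nonneg _).trans (norm_iteratedDerivWithin_le_maxDeriv (hap.trans_lt hpb) hf
        (hsub hs))
    have h := taylor_mean_remainder_bound (n := n) (C := maxDeriv (n + 1) a b f) hpb.le
      (by exact_mod_cast hf.mono hsub) hs ?_
    · rw [taylor_within_apply] at h
      rw [Polynomial.eval_finsetSum]
      refine le_trans (le_of_eq ?_) (h.trans ?_)
      · congr 2
        refine Finset.sum_congr rfl fun k _ => ?_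
        simp only [Polynomial.eval_mul, Polynomial.eval_C, Polynomial.eval_pow,
          Polynomial.eval_sub, Polynomial.eval_X, Complex.real_smul]
        push_cast
        ring
      · refine div_le_self (mul_nonneg h0 (pow_nonneg (by linarith [hs.1]) _)) ?_
        exact_mod_cast Nat.one_le_iff_ne_zero.2 n.factorial_ne_zero
    · intro y hy
      -- Shrinking the interval does not change the derivatives of a `C^m` function, even at the
      -- one-sided end points.
      have e : iteratedDerivWithin (n + 1) f (Icc p b) y
          = iteratedDerivWithin (n + 1) f (Icc a b) y := by
        unfold iteratedDerivWithin
        rw [iteratedFDerivWithin_subset hsub (uniqueDiffOn_Icc hpb)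
          (uniqueDiffOn_Icc (hap.trans_lt hpb)) hf hy]
      rw [e]
      exact norm_iteratedDerivWithin_le_maxDeriv (hap.trans_lt hpb) hf (hsub hy)

/-- A bound for the error of interpolation of noisy data on one piece. -/
lemma norm_blockPoly_sub_le {m : ℕ} (hm : 1 ≤ m) {ρ : ℝ} (hρ : 1 ≤ ρ) {a b : ℝ} {L r : ℕ}
    {x : ℕ → ℝ} (hr : r < m) (hx : IsNodeSeq a b (L * m + r) x)
    (hmesh : MeshRatioLe ρ (L * m + r) x) {f F : ℝ → ℂ} (hf : ContDiffOn ℝ m f (Icc a b))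
    {ν : ℝ} (hν : meshNorm (L * m + r) x ^ m * maxDeriv m a b f ≤ ν)
    (hF : ∀ u, ‖F u - f u‖ + meshNorm (L * m + r) x ^ m * maxDeriv m a b f ≤ ν)
    {j : ℕ} (hj : j < L) {u : ℝ} (hu : u ∈ piece m L r x j) :
    ‖(blockPoly m x F j).eval (u : ℂ) - f u‖ ≤
      (2 * m) ^ m * (m * (2 * m * ρ ^ (4 * m)) ^ m + 1) * ν := by
  set N := L * m + r with hN
  set i₀ := j * m with hi₀
  have hρ0 : 0 < ρ := zero_lt_one.trans_le hρ
  have hjL : (j + 1) * m ≤ L * m := Nat.mul_le_mul_right m hj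
  have hj1 : (j + 1) * m = i₀ + m := by rw [hi₀]; ring
  -- The last piece is longer by `r < m` gaps, so `2m` gaps from `x i₀` cover any piece.
  obtain ⟨s, hs1, hs2, hsN, hus⟩ : ∃ s, i₀ + m ≤ s ∧ s ≤ i₀ + 2 * m ∧ s ≤ N ∧ u ≤ x s := by
    obtain ⟨-, -, h3, h4⟩ := mem_piece_iff.1 hu
    by_cases h : j + 1 = L
    · refine ⟨N, by omega, ?_, le_rfl, h3 h⟩
      rw [hN, ← h]; omega
    · exact ⟨(j + 1) * m, by omega, by omega, by omega, h4 h⟩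
  have hpu : x i₀ ≤ u := by
    obtain ⟨h1, h2, -, -⟩ := mem_piece_iff.1 hu
    by_cases h : j = 0
    · rw [hi₀, h, zero_mul]; exact h1 h
    · exact (h2 h).le
  have hap : a ≤ x i₀ := hx.1 ▸ hx.le (Nat.zero_le _) (by omega)
  have hpb : x i₀ < b := hx.2.1 ▸ hx.lt (i := i₀) (by omega) le_rfl
  have hsb : x s ≤ b := hx.2.1 ▸ hx.le hsN le_rfl
  set g := x (i₀ + 1) - x i₀ with hg
  have hg0 : 0 < g := sub_pos.2 (hx.lt (by omega) (by omega))
  -- One factor `ρ ^ (2m)` bounds the block length by the first gap `g`, the other bounds `g` by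
  -- node distances.
  set W : ℝ := 2 * m * ρ ^ (4 * m) with hW
  have hm1 : (1 : ℝ) ≤ m := by exact_mod_cast hm
  have hW1 : 1 ≤ W := by
    have := one_le_pow₀ hρ (n := 4 * m)
    nlinarith
  have hlen : x s - x i₀ ≤ 2 * m * (ρ ^ (2 * m) * g) := by
    refine (sub_le_mul_of_gap_le (G := ρ ^ (2 * m) * g) (by omega) fun l h1 h2 =>
      (hmesh.gap_le hρ hx h1 (by omega) (by omega)).1).trans ?_
    refine mul_le_mul_of_nonneg_right ?_ (by positivity)
    exact_mod_cast (by omega : s - i₀ ≤ 2 * m)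
  have hΔ0 : 0 ≤ meshNorm N x := hg0.le.trans (gap_le_meshNorm x (by omega))
  have hlen' : x s - x i₀ ≤ 2 * m * meshNorm N x := by
    refine (sub_le_mul_of_gap_le (G := meshNorm N x) (by omega) fun l h1 h2 =>
      gap_le_meshNorm x (by omega)).trans ?_
    refine mul_le_mul_of_nonneg_right ?_ hΔ0
    exact_mod_cast (by omega : s - i₀ ≤ 2 * m)
  have hnode : ∀ i < m, x i₀ < x (i₀ + 1 + i) ∧ x (i₀ + 1 + i) ≤ x s := fun i hi =>
    ⟨hx.lt (by omega) (by omega), hx.le (by omega) hsN⟩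
  have hsep : ∀ i k : ℕ, i < k → k < m → g ≤ ρ ^ (2 * m) * (x (i₀ + 1 + k) - x (i₀ + 1 + i)) := by
    intro i k hik hk
    refine ((hmesh.gap_le hρ hx (i := i₀) (k := i₀ + 1 + i) (d := 2 * m) (by omega) (by omega)
      (by omega)).2).trans ?_
    gcongr
    exact hx.le (by omega) (by omega)
  have hsep' : ∀ i < m, ∀ k < m, i ≠ k → g ≤ ρ ^ (2 * m) * |x (i₀ + 1 + i) - x (i₀ + 1 + k)| := by
    intro i hi k hk hik
    rcases lt_or_gt_of_ne hik with h | h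
    · refine (hsep i k h hk).trans (mul_le_mul_of_nonneg_left ?_ (by positivity))
      rw [abs_sub_comm]; exact le_abs_self _
    · exact (hsep k i h hi).trans (mul_le_mul_of_nonneg_left (le_abs_self _) (by positivity))
  have hratio : ∀ i < m, ∀ k < m, i ≠ k →
      |u - x (i₀ + 1 + k)| ≤ W * |x (i₀ + 1 + i) - x (i₀ + 1 + k)| := by
    intro i hi k hk hik
    have h1 : |u - x (i₀ + 1 + k)| ≤ x s - x i₀ := by
      rw [abs_le]; constructor <;> linarith [hnode k hk]
    calc |u - x (i₀ + 1 + k)| ≤ 2 * m * (ρ ^ (2 * m) * g) := h1.trans hlen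
      _ ≤ 2 * m * (ρ ^ (2 * m) * (ρ ^ (2 * m) * |x (i₀ + 1 + i) - x (i₀ + 1 + k)|)) := by
          have := hsep' i hi k hk hik
          gcongr
      _ = W * |x (i₀ + 1 + i) - x (i₀ + 1 + k)| := by
          rw [hW, show 4 * m = 2 * m + 2 * m by ring, pow_add]; ring
  obtain ⟨P, hPdeg, hP⟩ := exists_taylor_polynomial hm hap hpb hf
  have hD0 : 0 ≤ maxDeriv m a b f :=
    (norm_nonneg _).trans (norm_iteratedDerivWithin_le_maxDeriv (hap.trans_lt hpb) hf
      ⟨hap, hpb.le⟩)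
  have hP' : ∀ v, x i₀ ≤ v → v ≤ x s →
      ‖f v - P.eval (v : ℂ)‖ ≤ (2 * m) ^ m * (meshNorm N x ^ m * maxDeriv m a b f) := by
    intro v h1 h2
    refine (hP v ⟨h1, h2.trans hsb⟩).trans ?_
    calc maxDeriv m a b f * (v - x i₀) ^ m
        ≤ maxDeriv m a b f * (2 * m * meshNorm N x) ^ m := by
          refine mul_le_mul_of_nonneg_left (pow_le_pow_left₀ (by linarith) (by linarith) _) hD0
      _ = _ := by rw [mul_pow]; ring
  have hinj : Set.InjOn (fun i => ((x (i₀ + 1 + i) : ℝ) : ℂ)) (Finset.range m) := by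
    intro i hi k hk hik
    by_contra hne
    have h := hsep' i (by simpa using hi) k (by simpa using hk) hne
    rw [Complex.ofReal_injective hik] at h
    simp only [sub_self, abs_zero, mul_zero] at h
    linarith
  -- Interpolation reproduces the Taylor polynomial `P`, so only the data `F - P` at the nodes has
  -- to be estimated.
  have hrep := Lagrange.eq_interpolate hinj (f := P) (by simpa using hPdeg)
  have hsplit : (blockPoly m x F j).eval (u : ℂ) - P.eval (u : ℂ) =
      (Lagrange.interpolate (Finset.range m) (fun i => ((x (i₀ + 1 + i) : ℝ) : ℂ))
        (fun i => F (x (i₀ + 1 + i)) - P.eval ((x (i₀ + 1 + i) : ℝ) : ℂ))).eval (u : ℂ) := by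
    conv_lhs => rw [hrep]
    rw [blockPoly, ← Polynomial.eval_sub, ← map_sub]
    rfl
  have h2m : (1 : ℝ) ≤ (2 * m) ^ m := one_le_pow₀ (by linarith)
  have hdata : ∀ i < m, ‖F (x (i₀ + 1 + i)) - P.eval ((x (i₀ + 1 + i) : ℝ) : ℂ)‖
      ≤ (2 * m) ^ m * ν := by
    intro i hi
    have h1 := hP' _ (hnode i hi).1.le (hnode i hi).2
    have h2 := hF (x (i₀ + 1 + i))
    have h3 := norm_sub_le_norm_sub_add_norm_sub (F (x (i₀ + 1 + i))) (f (x (i₀ + 1 + i)))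
      (P.eval ((x (i₀ + 1 + i) : ℝ) : ℂ))
    have h4 : ‖F (x (i₀ + 1 + i)) - f (x (i₀ + 1 + i))‖
        ≤ (2 * m) ^ m * ‖F (x (i₀ + 1 + i)) - f (x (i₀ + 1 + i))‖ :=
      le_mul_of_one_le_left (norm_nonneg _) h2m
    nlinarith [mul_le_mul_of_nonneg_left h2 (zero_le_one.trans h2m)]
  have h1 := norm_eval_interpolate_le hW1 hratio hdata
  rw [← hsplit] at h1
  have h2 := hP' u hpu hus
  have h3 : (2 * m : ℝ) ^ m * (meshNorm N x ^ m * maxDeriv m a b f) ≤ (2 * m) ^ m * ν := by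
    gcongr
  have h4 := norm_sub_le_norm_sub_add_norm_sub ((blockPoly m x F j).eval (u : ℂ))
    (P.eval (u : ℂ)) (f u)
  rw [norm_sub_rev (P.eval (u : ℂ))] at h4
  linarith

lemma norm_interpQ_sub_le {m : ℕ} (hm : 1 ≤ m) {ρ : ℝ} (hρ : 1 ≤ ρ) {a b : ℝ} {L r : ℕ}
    (hL : 1 ≤ L) {x : ℕ → ℝ} (hr : r < m) (hx : IsNodeSeq a b (L * m + r) x)
    (hmesh : MeshRatioLe ρ (L * m + r) x) {f F : ℝ → ℂ} (hf : ContDiffOn ℝ m f (Icc a b))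
    (hf0 : ∀ u, u ∉ Icc a b → f u = 0) {ν : ℝ}
    (hF : ∀ u, meshNorm (L * m + r) x ^ m * maxDeriv m a b f + ‖F u - f u‖ ≤ ν) (u : ℝ) :
    ‖interpQ m L r x F u - f u‖ ≤ (2 * m) ^ m * (m * (2 * m * ρ ^ (4 * m)) ^ m + 1) * ν := by
  have hρ0 : 0 ≤ ρ := zero_le_one.trans hρ
  have hν : meshNorm (L * m + r) x ^ m * maxDeriv m a b f ≤ ν := by
    linarith [hF u, norm_nonneg (F u - f u)]
  by_cases hu : u ∈ Icc a b
  · rw [← hx.1, ← hx.2.1] at hu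
    obtain ⟨j, hj, hju⟩ := exists_mem_piece (m := m) (r := r) hL hu.1 hu.2
    rw [interpQ_of_mem hx F hj hju]
    exact norm_blockPoly_sub_le hm hρ hr hx hmesh hf hν (fun u => by linarith [hF u]) hj hju
  · rw [interpQ_of_notMem hx F hu, hf0 u hu, sub_zero, norm_zero]
    have hD : 0 ≤ maxDeriv m a b f := Real.sSup_nonneg (by rintro _ ⟨s, -, rfl⟩; positivity)
    have hM : 0 ≤ meshNorm (L * m + r) x :=
      Real.iSup_nonneg fun k => sub_nonneg.2 (hx.2.2 k k.2).le
    have : 0 ≤ ν := (by positivity : (0 : ℝ) ≤ _).trans hν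
    positivity

/-! ### The window and its kernel -/

namespace IsAdmissibleWindow

variable {h : ℝ → ℝ}

/-- Continuity also kills the end points `±1`. This removes `|j| = n` from the sums, where
minimality of `n` gives no control. -/
lemma eq_zero (hh : IsAdmissibleWindow h) {y : ℝ} (hy : 1 ≤ |y|) : h y = 0 := by
  have hsupp : ∀ z : ℝ, 1 < z → h z = 0 := by
    intro z hz
    by_contra hne
    exact absurd (hh.support_subset hne).2 (not_le.2 hz)
  have h1 : ∀ z : ℝ, 1 ≤ z → h z = 0 := by
    intro z hz
    have hcl : IsClosed {z | h z = 0} := isClosed_eq hh.contDiff.continuous continuous_const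
    have : closure (Ioi (1 : ℝ)) ⊆ {z | h z = 0} := hcl.closure_subset_iff.2 hsupp
    rw [closure_Ioi] at this
    exact this hz
  rcases le_abs'.1 hy with hy | hy
  · rw [← hh.even]; exact h1 _ (by linarith)
  · exact h1 y hy

lemma hasCompactSupport (hh : IsAdmissibleWindow h) : HasCompactSupport h :=
  HasCompactSupport.of_support_subset_isCompact isCompact_Icc hh.support_subset

lemma div_eq_zero (hh : IsAdmissibleWindow h) {n : ℕ} (hn : 0 < n) {j : ℤ} (hj : (n : ℤ) ≤ |j|) :
    h (j / n) = 0 := by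
  have hn' : (0 : ℝ) < n := by exact_mod_cast hn
  apply hh.eq_zero
  rw [abs_div, abs_of_pos hn', one_le_div hn']
  exact_mod_cast hj

lemma support_finite (hh : IsAdmissibleWindow h) {n : ℕ} (hn : 0 < n) :
    (Function.support fun j : ℤ => h (j / n)).Finite := by
  refine (Set.finite_Icc (-(n : ℤ)) n).subset fun j hj => ?_
  by_contra hne
  refine hj (hh.div_eq_zero hn (le_of_not_gt fun hlt => hne ?_))
  exact abs_le.1 hlt.le

lemma summable (hh : IsAdmissibleWindow h) {n : ℕ} (hn : 0 < n) :
    Summable fun j : ℤ => h (j / n) :=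
  summable_of_hasFiniteSupport (hh.support_finite hn)

lemma summable_mul (hh : IsAdmissibleWindow h) {n : ℕ} (hn : 0 < n) (g : ℤ → ℂ) :
    Summable fun j : ℤ => (h (j / n) : ℂ) * g j := by
  refine summable_of_hasFiniteSupport ((hh.support_finite hn).subset fun j hj h0 => hj ?_)
  simp only at h0 ⊢
  simp [h0]

/-- `h > h y / 2` on an interval of length `s` to the right of `y`, which contains at least `sn - 1
≥ sn/2` points `j/n` once `sn ≥ 2`. -/
lemma exists_mul_le_hbar (hh : IsAdmissibleWindow h) :
    ∃ κ > 0, ∃ n₀ : ℕ, ∀ n : ℕ, n₀ ≤ n → κ * n ≤ hbar h n := by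
  obtain ⟨y, hy⟩ := hh.pos
  have hev := hh.contDiff.continuous.continuousAt.eventually_const_lt
    (show h y / 2 < h y by linarith)
  obtain ⟨s, hs, hball⟩ := Metric.eventually_nhds_iff.1 hev
  obtain ⟨n₀, hn₀⟩ := exists_nat_gt (2 / s)
  refine ⟨h y / 2 * (s / 2), by positivity, n₀ + 1, fun n hn => ?_⟩
  have hn1 : 0 < n := by omega
  have hn' : (0 : ℝ) < n := by exact_mod_cast hn1
  have hns : 2 ≤ s * n := by
    have h1 : (n₀ : ℝ) ≤ n := by exact_mod_cast (by omega : n₀ ≤ n)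
    have h2 : 2 / s < n := hn₀.trans_le h1
    rw [div_lt_iff₀ hs] at h2
    linarith
  set S : Finset ℤ := Finset.Ioc ⌊(y * n : ℝ)⌋ (⌈(y * n + s * n : ℝ)⌉ - 1) with hS
  have hmem : ∀ j ∈ S, h y / 2 ≤ h (j / n) := by
    intro j hj
    rw [hS, Finset.mem_Ioc] at hj
    have h1 := Int.floor_lt.1 hj.1
    have h2 := Int.lt_ceil.1 (show j < ⌈(y * n + s * n : ℝ)⌉ by omega)
    refine (hball ?_).le
    rw [Real.dist_eq, abs_lt]
    have e : (j / n : ℝ) - y = (j - y * n) / n := by field_simp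
    rw [e, lt_div_iff₀ hn', div_lt_iff₀ hn']
    constructor <;> nlinarith
  have hcard : s / 2 * n ≤ S.card := by
    rw [hS, Int.card_Ioc]
    have h1 := Int.floor_le (y * n : ℝ)
    have h2 := Int.le_ceil (y * n + s * n : ℝ)
    have h3 : (((⌈(y * n + s * n : ℝ)⌉ - 1 - ⌊(y * n : ℝ)⌋ : ℤ)) : ℝ) ≤
        ((⌈(y * n + s * n : ℝ)⌉ - 1 - ⌊(y * n : ℝ)⌋ : ℤ).toNat : ℝ) := by
      exact_mod_cast Int.self_le_toNat _
    push_cast at h3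
    linarith
  calc h y / 2 * (s / 2) * n = (s / 2 * n) * (h y / 2) := by ring
    _ ≤ S.card * (h y / 2) := by gcongr
    _ = ∑ j ∈ S, h y / 2 := by simp
    _ ≤ ∑ j ∈ S, h (j / n) := Finset.sum_le_sum hmem
    _ ≤ hbar h n := (hh.summable hn1).sum_le_tsum S fun j _ => hh.nonneg _

/-- As a function of `s`, the second difference has derivative `h'(y+s) - h'(y-s)`, and `h'` is
Lipschitz. -/
lemma exists_second_difference_le (hh : IsAdmissibleWindow h) :
    ∃ D > 0, ∀ y s : ℝ, 0 ≤ s → |h (y + s) - 2 * h y + h (y - s)| ≤ D * s ^ 2 := by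
  have hd : ContDiff ℝ 1 (deriv h) := by
    have : ContDiff ℝ (1 + 1) h := hh.contDiff.of_le (by norm_num)
    exact (contDiff_succ_iff_deriv.1 this).2.2
  obtain ⟨C, hC⟩ := hd.lipschitzWith_of_hasCompactSupport hh.hasCompactSupport.deriv one_ne_zero
  have hdiff : Differentiable ℝ h := hh.contDiff.differentiable (by norm_num)
  refine ⟨2 * C + 1, by positivity, fun y s hs => ?_⟩
  have hder : ∀ v, HasDerivAt (fun v => h (y + v) - 2 * h y + h (y - v))
      (deriv h (y + v) - deriv h (y - v)) v := by
    intro v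
    have h1 := (hdiff (y + v)).hasDerivAt.comp_const_add y v
    have h2 := (hdiff (y - v)).hasDerivAt.comp_const_sub y v
    exact ((h1.sub_const (2 * h y)).add h2).congr_deriv (by ring)
  have hb := norm_image_sub_le_of_norm_deriv_le_segment' (C := 2 * C * s)
    (fun v _ => (hder v).hasDerivWithinAt) (fun v hv => ?_) s (right_mem_Icc.2 hs)
  · simp only [add_zero, sub_zero, Real.norm_eq_abs] at hb
    rw [show h y - 2 * h y + h y = 0 by ring, sub_zero] at hb
    nlinarith [sq_nonneg s]
  · have := hC.dist_le_mul (y + v) (y - v)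
    rw [dist_eq_norm, Real.dist_eq, show y + v - (y - v) = 2 * v by ring, abs_of_nonneg
      (by linarith [hv.1])] at this
    refine this.trans ?_
    have := mul_le_mul_of_nonneg_left hv.2.le C.2
    simp only [NNReal.val_eq_coe] at this
    linarith

end IsAdmissibleWindow

/-- Summation by parts, twice: shifting the coefficients by `c` multiplies the series by
`exp(-icu)`. -/
lemma kernelPhi_mul_eq {h : ℝ → ℝ} (hh : IsAdmissibleWindow h) {n : ℕ} (hn : 0 < n) (u : ℝ) :
    ((2 - 2 * Real.cos u : ℝ) : ℂ) * kernelPhi h n u =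
      -∑' k : ℤ, ((h (k / n + 1 / n) - 2 * h (k / n) + h (k / n - 1 / n) : ℝ) : ℂ) *
        Complex.exp (Complex.I * k * u) := by
  set e : ℤ → ℂ := fun k => Complex.exp (Complex.I * k * u) with he
  have hshift : ∀ (c : ℤ), HasSum (fun k : ℤ => (h (k / n + c / n) : ℂ) * e k)
      (e (-c) * kernelPhi h n u) := by
    intro c
    have h1 := ((hh.summable_mul hn e).hasSum).mul_left (e (-c))
    rw [← (Equiv.addRight c).hasSum_iff] at h1
    suffices hfun : (fun k : ℤ => (h (k / n + c / n) : ℂ) * e k) =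
        (fun i : ℤ => e (-c) * ((h (i / n) : ℂ) * e i)) ∘ Equiv.addRight c by
      rw [hfun]
      exact h1
    funext k
    have hek : e k = e (-c) * e (k + c) := by
      rw [he, ← Complex.exp_add]
      push_cast
      ring_nf
    have hadd : (k / n + c / n : ℝ) = ((k + c : ℤ) : ℝ) / n := by push_cast; ring
    simp only [Function.comp_apply, Equiv.coe_addRight]
    rw [hek, hadd]
    ring
  have hsum := ((hshift 1).add (hshift (-1))).sub ((hshift 0).mul_left 2)
  have hcos : e (-1) + e 1 = ((2 * Real.cos u : ℝ) : ℂ) := by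
    simp only [he]
    push_cast
    rw [Complex.two_cos]
    ring_nf
  have h0 : e 0 = 1 := by simp [he]
  have hval : e (-1) * kernelPhi h n u + e (- -1) * kernelPhi h n u
      - 2 * (e (-0) * kernelPhi h n u) = -(((2 - 2 * Real.cos u : ℝ) : ℂ) * kernelPhi h n u) := by
    rw [neg_neg, neg_zero, h0, ← add_mul, hcos]
    push_cast
    ring
  rw [hval] at hsum
  rw [← neg_eq_iff_eq_neg, ← hsum.tsum_eq]
  refine tsum_congr fun k => ?_
  have e1 : (k / n - 1 / n : ℝ) = k / n + ((-1 : ℤ) : ℝ) / n := by push_cast; ring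
  have e2 : (k / n + 1 / n : ℝ) = k / n + ((1 : ℤ) : ℝ) / n := by push_cast; ring
  have e3 : (k / n : ℝ) = k / n + ((0 : ℤ) : ℝ) / n := by push_cast; ring
  rw [e1, e2]
  nth_rewrite 2 [e3]
  simp only [he]
  push_cast
  ring_nf

lemma IsAdmissibleWindow.norm_kernelPhi_mul_le {h : ℝ → ℝ} (hh : IsAdmissibleWindow h) {D : ℝ}
    (hD : ∀ y s : ℝ, 0 ≤ s → |h (y + s) - 2 * h y + h (y - s)| ≤ D * s ^ 2)
    {n : ℕ} (hn : 0 < n) (u : ℝ) :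
    (2 - 2 * Real.cos u) * ‖kernelPhi h n u‖ * n ≤ 5 * D := by
  have hn' : (1 : ℝ) ≤ n := by exact_mod_cast hn
  have hD0 : 0 ≤ D := by simpa using (abs_nonneg _).trans (hD 0 1 zero_le_one)
  have hcos : 0 ≤ 2 - 2 * Real.cos u := by linarith [Real.cos_le_one u]
  have hsupp : ∀ k ∉ Finset.Icc (-(n + 1) : ℤ) (n + 1),
      ((h (k / n + 1 / n) - 2 * h (k / n) + h (k / n - 1 / n) : ℝ) : ℂ) *
        Complex.exp (Complex.I * k * u) = 0 := by
    intro k hk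
    have hk' : (n : ℤ) + 1 < |k| := by
      by_contra hlt
      exact hk (Finset.mem_Icc.2 (abs_le.1 (not_lt.1 hlt)))
    have h1 : h (k / n + 1 / n) = 0 := by
      rw [← add_div]
      have := hh.div_eq_zero hn (j := k + 1) (by grind)
      exact_mod_cast this
    have h2 : h (k / n) = 0 := hh.div_eq_zero hn (by omega)
    have h3 : h (k / n - 1 / n) = 0 := by
      rw [← sub_div]
      have := hh.div_eq_zero hn (j := k - 1) (by grind)
      exact_mod_cast this
    rw [h1, h2, h3]
    simp
  have hterm : ∀ k ∈ Finset.Icc (-(n + 1) : ℤ) (n + 1),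
      ‖((h (k / n + 1 / n) - 2 * h (k / n) + h (k / n - 1 / n) : ℝ) : ℂ) *
        Complex.exp (Complex.I * k * u)‖ ≤ D * (1 / n) ^ 2 := by
    intro k _
    have : ‖Complex.exp (Complex.I * k * u)‖ = 1 := by
      rw [show Complex.I * k * u = Complex.I * ((k * u : ℝ) : ℂ) by push_cast; ring]
      exact Complex.norm_exp_I_mul_ofReal _
    rw [norm_mul, this, mul_one, Complex.norm_real]
    exact hD _ _ (by positivity)
  -- There are `2n + 3 ≤ 5n` terms, each at most `D/n²`.
  have hcard : ((Finset.Icc (-(n + 1) : ℤ) (n + 1)).card : ℝ) ≤ 5 * n := by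
    rw [Int.card_Icc]
    have : ((n : ℤ) + 1 + 1 - -(n + 1)).toNat ≤ 5 * n := by omega
    exact_mod_cast this
  have hmain : ‖((2 - 2 * Real.cos u : ℝ) : ℂ) * kernelPhi h n u‖ ≤ 5 * n * (D * (1 / n) ^ 2) := by
    rw [kernelPhi_mul_eq hh hn, norm_neg, tsum_eq_sum hsupp]
    refine (norm_sum_le_of_le _ hterm).trans ?_
    rw [Finset.sum_const, nsmul_eq_mul]
    gcongr
  rw [norm_mul, Complex.norm_real, Real.norm_eq_abs, abs_of_nonneg hcos] at hmain
  calc (2 - 2 * Real.cos u) * ‖kernelPhi h n u‖ * n ≤ 5 * n * (D * (1 / n) ^ 2) * n := by gcongr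
    _ = 5 * D := by field_simp

/-- Localization of the kernel, together with positivity of the normalizing factor. -/
lemma IsAdmissibleWindow.exists_norm_kernelPhi_le {h : ℝ → ℝ} (hh : IsAdmissibleWindow h) :
    ∃ D > 0, ∃ n₀ : ℕ, ∀ n : ℕ, n₀ ≤ n → 0 < n → 0 < hbar h n ∧
      ∀ u : ℝ, |u| ≤ Real.pi → ‖kernelPhi h n u‖ * (n * u) ^ 2 ≤ D * hbar h n := by
  obtain ⟨κ, hκ, n₀, hn₀⟩ := hh.exists_mul_le_hbar
  obtain ⟨D, hD, hsd⟩ := hh.exists_second_difference_le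
  refine ⟨5 * D * Real.pi ^ 2 / κ, by positivity, n₀, fun n hn hn1 => ?_⟩
  have hn' : (0 : ℝ) < n := by exact_mod_cast hn1
  have hhb := hn₀ n hn
  refine ⟨(by positivity : 0 < κ * n).trans_le hhb, fun u hu => ?_⟩
  have h1 := hh.norm_kernelPhi_mul_le hsd hn1 u
  -- On `[-π, π]`, `cos u ≤ 1 - 2u²/π²`, so the factor `2 - 2 cos u` is at least `4u²/π²`.
  have h2 := Real.cos_le_one_sub_mul_cos_sq hu
  have h3 : u ^ 2 ≤ Real.pi ^ 2 * (2 - 2 * Real.cos u) := by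
    have h4 : 2 / Real.pi ^ 2 * u ^ 2 ≤ 1 - Real.cos u := by linarith
    rw [div_mul_eq_mul_div, div_le_iff₀ (by positivity)] at h4
    have : 0 ≤ u ^ 2 := sq_nonneg u
    linarith
  calc ‖kernelPhi h n u‖ * (n * u) ^ 2 = ‖kernelPhi h n u‖ * n ^ 2 * u ^ 2 := by ring
    _ ≤ ‖kernelPhi h n u‖ * n ^ 2 * (Real.pi ^ 2 * (2 - 2 * Real.cos u)) := by gcongr
    _ = Real.pi ^ 2 * n * ((2 - 2 * Real.cos u) * ‖kernelPhi h n u‖ * n) := by ring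
    _ ≤ Real.pi ^ 2 * n * (5 * D) := by gcongr
    _ = 5 * D * Real.pi ^ 2 / κ * (κ * n) := by field_simp
    _ ≤ 5 * D * Real.pi ^ 2 / κ * hbar h n := by gcongr

/-! ### The operator -/

lemma norm_exp_I_mul_mul (j : ℤ) (θ : ℝ) : ‖Complex.exp (Complex.I * j * θ)‖ = 1 := by
  rw [show Complex.I * j * θ = Complex.I * ((j * θ : ℝ) : ℂ) by push_cast; ring]
  exact Complex.norm_exp_I_mul_ofReal _

namespace IsAdmissibleWindow

variable {h : ℝ → ℝ}

/-- The weights `h(j/n)/ħₙ` are nonnegative with sum `1`, the phases are unimodular, and only `|j| <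
n` contributes. -/
lemma norm_sso_sub_le (hh : IsAdmissibleWindow h) {n : ℕ} (hn : 0 < n) (hpos : 0 < hbar h n)
    {δ u θ V : ℝ} {G G' : ℝ → ℂ}
    (hG : ∀ j : ℤ, |j| < n → ‖G (u - j * δ) - G' (u - j * δ)‖ ≤ V) :
    ‖sso h n δ G u θ - sso h n δ G' u θ‖ ≤ V := by
  unfold sso
  simp only [mul_assoc ((h _ : ℝ) : ℂ)]
  rw [← mul_sub, ← (hh.summable_mul hn _).tsum_sub (hh.summable_mul hn _)]
  simp only [← mul_sub]
  have hterm : ∀ j : ℤ, ‖(h (j / n) : ℂ) * (Complex.exp (Complex.I * j * θ) *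
      (G (u - j * δ) - G' (u - j * δ)))‖ ≤ h (j / n) * V := by
    intro j
    rw [norm_mul, norm_mul, norm_exp_I_mul_mul, one_mul, Complex.norm_real, Real.norm_eq_abs,
      abs_of_nonneg (hh.nonneg _)]
    by_cases hj : |j| < n
    · exact mul_le_mul_of_nonneg_left (hG j hj) (hh.nonneg _)
    · rw [hh.div_eq_zero hn (not_lt.1 hj), zero_mul, zero_mul]
  have hs := tsum_of_norm_bounded ((hh.summable hn).hasSum.mul_right V) hterm
  rw [norm_mul, norm_div, norm_one, Complex.norm_real, Real.norm_eq_abs, abs_of_pos hpos,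
    one_div, inv_mul_le_iff₀ hpos]
  exact hs

lemma sso_exponential_sum (hh : IsAdmissibleWindow h) {n : ℕ} (hn : 0 < n) {K : ℕ}
    (δ u θ : ℝ) (c : Fin K → ℂ) (w : Fin K → ℝ) :
    sso h n δ (fun v => ∑ l, c l * Complex.exp (Complex.I * ((v - u) * w l : ℝ))) u θ =
      ∑ l, c l * (kernelPhi h n (θ - δ * w l) / hbar h n) := by
  unfold sso kernelPhi
  have hterm : ∀ j : ℤ, (h (j / n) : ℂ) * Complex.exp (Complex.I * j * θ) *
      ∑ l, c l * Complex.exp (Complex.I * ((u - j * δ - u) * w l : ℝ)) =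
      ∑ l, c l * ((h (j / n) : ℂ) * Complex.exp (Complex.I * j * (θ - δ * w l : ℝ))) := by
    intro j
    rw [Finset.mul_sum]
    refine Finset.sum_congr rfl fun l _ => ?_
    rw [show Complex.I * j * ((θ - δ * w l : ℝ) : ℂ) = Complex.I * j * θ +
      Complex.I * ((u - j * δ - u) * w l : ℝ) by push_cast; ring, Complex.exp_add]
    ring
  simp only [hterm]
  rw [Summable.tsum_finsetSum fun l _ => (hh.summable_mul hn _).mul_left _, Finset.mul_sum]
  refine Finset.sum_congr rfl fun l _ => ?_
  rw [tsum_mul_left]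
  ring

lemma continuous_sso (hh : IsAdmissibleWindow h) {n : ℕ} (hn : 0 < n) (δ u : ℝ) (G : ℝ → ℂ) :
    Continuous fun θ => sso h n δ G u θ := by
  have heq : ∀ θ, sso h n δ G u θ = (1 / (hbar h n : ℂ)) * ∑ j ∈ (hh.support_finite hn).toFinset,
      (h (j / n) : ℂ) * Complex.exp (Complex.I * j * θ) * G (u - j * δ) := by
    intro θ
    unfold sso
    rw [tsum_eq_sum]
    intro j hj
    have : h (j / n) = 0 := by simpa using hj
    simp [this]
  simp only [heq]
  fun_prop

lemma norm_kernelPhi_le (hh : IsAdmissibleWindow h) {n : ℕ} (hn : 0 < n) (u : ℝ) :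
    ‖kernelPhi h n u‖ ≤ hbar h n := by
  refine tsum_of_norm_bounded (hh.summable hn).hasSum fun j => ?_
  rw [norm_mul, norm_exp_I_mul_mul, mul_one, Complex.norm_real, Real.norm_eq_abs,
    abs_of_nonneg (hh.nonneg _)]

end IsAdmissibleWindow

lemma kernelPhi_zero (h : ℝ → ℝ) (n : ℕ) : kernelPhi h n 0 = hbar h n := by
  simp [kernelPhi, hbar, Complex.ofReal_tsum]

/-! ### The signal near the time `t` -/

lemma abs_deriv_le_maxFreq {K : ℕ} (φ : Fin K → ℝ → ℝ) (t : ℝ) (j : Fin K) :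
    |deriv (φ j) t| ≤ maxFreq φ t :=
  le_ciSup (f := fun j => |deriv (φ j) t|) (Set.finite_range _).bddAbove j

lemma minAmp_le {K : ℕ} (A : Fin K → ℝ → ℂ) (t : ℝ) (j : Fin K) : minAmp A t ≤ ‖A j t‖ :=
  ciInf_le (f := fun j => ‖A j t‖) (Set.finite_range _).bddBelow j

lemma norm_le_totalAmp {K : ℕ} (A : Fin K → ℝ → ℂ) (t : ℝ) (j : Fin K) :
    ‖A j t‖ ≤ totalAmp A t :=
  Finset.single_le_sum (f := fun j => ‖A j t‖) (fun _ _ => norm_nonneg _) (Finset.mem_univ j)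

lemma freqGap_le {K : ℕ} (φ : Fin K → ℝ → ℝ) (t : ℝ) {j l : Fin K} (hjl : j ≠ l) :
    freqGap φ t ≤ |deriv (φ j) t - deriv (φ l) t| := by
  have h := ciInf_le (f := fun p : {p : Fin (K + 1) × Fin (K + 1) // p.1 ≠ p.2} =>
    |extFreq φ t p.1.1 - extFreq φ t p.1.2|) (Set.finite_range _).bddBelow
    ⟨(j.succ, l.succ), fun h => hjl (Fin.succ_injective _ h)⟩
  exact (show freqGap φ t ≤ _ from h).trans_eq (by simp [extFreq])

/-- The mean value inequality for the phase minus its tangent, whose slope is bounded by slow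
variation of the frequency. -/
lemma InClass.abs_phase_sub_le {K : ℕ} {A : Fin K → ℝ → ℂ} {φ : Fin K → ℝ → ℝ} {t α : ℝ}
    (hα : 0 < α) (hcl : InClass A φ t α) (j : Fin K) {v : ℝ}
    (hv : |v| ≤ α⁻¹ * (√(8 * Real.pi * maxFreq φ t))⁻¹) :
    |φ j (t + v) - φ j t - v * deriv (φ j) t| ≤ α ^ 3 * |v| ^ 2 * maxFreq φ t := by
  have hdiff : Differentiable ℝ (φ j) := (hcl.contDiff_phase j).differentiable one_ne_zero
  have hder : ∀ s, HasDerivAt (fun s => φ j (t + s) - φ j t - s * deriv (φ j) t)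
      (deriv (φ j) (t + s) - deriv (φ j) t) s := by
    intro s
    have h1 := (hdiff (t + s)).hasDerivAt.comp_const_add t s
    exact ((h1.sub_const (φ j t)).sub ((hasDerivAt_id s).mul_const (deriv (φ j) t))).congr_deriv
      (by ring)
  have hB := abs_deriv_le_maxFreq φ t j
  have hb : ∀ s ∈ Icc (-|v|) |v|, ‖deriv (φ j) (t + s) - deriv (φ j) t‖
      ≤ α ^ 3 * |v| * maxFreq φ t := by
    intro s hs
    have hs' : |s| ≤ |v| := abs_le.2 hs
    refine (hcl.freq_slow j s (hs'.trans hv)).trans ?_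
    gcongr
  have := (convex_Icc (-|v|) |v|).norm_image_sub_le_of_norm_hasDerivWithin_le
    (fun s _ => (hder s).hasDerivWithinAt) hb (x := 0) (y := v)
    ⟨by simp, by simp⟩ (abs_le.1 le_rfl)
  simp only [add_zero, sub_self, zero_mul, sub_zero, Real.norm_eq_abs] at this
  exact this.trans (le_of_eq (by ring))

/-- Near `t` the signal is an exponential sum with constant amplitudes and frequencies. -/
lemma InClass.norm_signal_sub_le {K : ℕ} {A : Fin K → ℝ → ℂ} {φ : Fin K → ℝ → ℝ} {t α : ℝ}
    (hα : 0 < α) (hcl : InClass A φ t α) (hB : 0 < maxFreq φ t)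
    (hαB : 2 * α ≤ √(8 * Real.pi * maxFreq φ t)) {v : ℝ}
    (hv : |v| ≤ α⁻¹ * (√(8 * Real.pi * maxFreq φ t))⁻¹) :
    ‖signal A φ (t + v) - ∑ l, A l t * Complex.exp (Complex.I * (φ l t : ℂ)) *
      Complex.exp (Complex.I * ((t + v - t) * deriv (φ l) t : ℝ))‖ ≤ totalAmp A t * α := by
  set B := maxFreq φ t with hBdef
  have hq : 0 < √(8 * Real.pi * B) := Real.sqrt_pos.2 (by positivity)
  have hq2 : √(8 * Real.pi * B) ^ 2 = 8 * Real.pi * B := Real.sq_sqrt (by positivity)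
  have hv1 : α * |v| * √(8 * Real.pi * B) ≤ 1 := by
    have := mul_le_mul_of_nonneg_left hv (by positivity : 0 ≤ α * √(8 * Real.pi * B))
    calc _ = α * √(8 * Real.pi * B) * |v| := by ring
      _ ≤ _ := this
      _ = 1 := by field_simp
  -- Amplitude drift and phase drift each get half of `α`: the first from `2α ≤ √(8πB)`, the second
  -- from `8π ≥ 2`.
  have hamp : α ^ 3 * |v| ≤ α / 2 := by
    have h1 : α * |v| * (2 * α) ≤ 1 := le_trans (by gcongr) hv1
    nlinarith
  have hph : α ^ 3 * |v| ^ 2 * B ≤ α / 2 := by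
    have h1 : (α * |v|) ^ 2 * (8 * Real.pi * B) ≤ 1 := by
      rw [← hq2, ← mul_pow]
      exact pow_le_one₀ (by positivity) hv1
    have h2 : (α * |v|) ^ 2 * (2 * B) ≤ (α * |v|) ^ 2 * (8 * Real.pi * B) := by
      gcongr
      linarith [Real.pi_gt_three]
    nlinarith
  unfold signal totalAmp
  rw [← Finset.sum_sub_distrib, Finset.sum_mul]
  refine norm_sum_le_of_le _ fun l _ => ?_
  have h1 := hcl.amp_slow l v hv
  have h2 := hcl.abs_phase_sub_le hα l hv
  set d := φ l (t + v) - φ l t - v * deriv (φ l) t with hd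
  have e1 : Complex.exp (Complex.I * (φ l (t + v) : ℂ)) = Complex.exp (Complex.I * (φ l t : ℂ)) *
      Complex.exp (Complex.I * ((t + v - t) * deriv (φ l) t : ℝ)) *
        Complex.exp (Complex.I * (d : ℂ)) := by
    rw [← Complex.exp_add, ← Complex.exp_add, hd]
    congr 1
    push_cast
    ring
  set p := Complex.exp (Complex.I * (φ l t : ℂ)) *
      Complex.exp (Complex.I * ((t + v - t) * deriv (φ l) t : ℝ)) with hp
  have hpn : ‖p‖ = 1 := by
    rw [hp, norm_mul, Complex.norm_exp_I_mul_ofReal, Complex.norm_exp_I_mul_ofReal, mul_one]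
  have e2 : A l (t + v) * (p * Complex.exp (Complex.I * (d : ℂ))) - A l t * p =
      (A l (t + v) - A l t) * (p * Complex.exp (Complex.I * (d : ℂ))) +
        A l t * p * (Complex.exp (Complex.I * (d : ℂ)) - 1) := by ring
  rw [e1, mul_assoc (A l t), ← hp, e2]
  refine (norm_add_le _ _).trans ?_
  simp only [norm_mul, hpn, Complex.norm_exp_I_mul_ofReal, mul_one]
  have h3 : ‖Complex.exp (Complex.I * (d : ℂ)) - 1‖ ≤ α / 2 :=
    Real.norm_exp_I_mul_ofReal_sub_one_le.trans (h2.trans hph)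
  have h4 : ‖A l (t + v) - A l t‖ ≤ α / 2 * ‖A l t‖ :=
    h1.trans (mul_le_mul_of_nonneg_right hamp (norm_nonneg _))
  nlinarith [mul_le_mul_of_nonneg_left h3 (norm_nonneg (A l t))]

/-! ### Clusters of large values of a perturbed sum of localized bumps -/

/-- The data of a function `T` close to `∑ₗ cₗ p(θ - ωₗ)` on `[0, π]`, where the bump `p` is at
most `1`, equals `1` at `0`, and is small outside the `σ`-neighbourhood of `0`, and the centres
`ωₗ` are separated. -/
structure BumpSum {K : ℕ} (c : Fin K → ℂ) (ω : Fin K → ℝ) (p T : ℝ → ℂ) (σ μ e₁ e₂ e : ℝ) :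
    Prop where
  continuous : Continuous T
  one : p 0 = 1
  le_one : ∀ u, ‖p u‖ ≤ 1
  approx : ∀ θ, ‖T θ - ∑ l, c l * p (θ - ω l)‖ ≤ e₁
  decay : ∀ u, σ < |u| → |u| ≤ Real.pi → ‖p u‖ ≤ e₂
  amp : ∀ l, μ ≤ ‖c l‖
  err : (∑ l, ‖c l‖) * e₂ + e₁ ≤ e
  err_le : 4 * e ≤ μ
  pos : 0 < μ
  sigma_pos : 0 < σ
  e₂_nonneg : 0 ≤ e₂
  mem : ∀ l, ω l ∈ Icc 0 Real.pi
  sep : ∀ l j, l ≠ j → 8 * σ ≤ |ω l - ω j|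

/-- The part near `ω` of the set where `|T|` is at least `μ / 2`. -/
def cluster (T : ℝ → ℂ) (μ σ ω : ℝ) : Set ℝ :=
  {θ | θ ∈ Icc 0 Real.pi ∧ μ / 2 ≤ ‖T θ‖ ∧ |θ - ω| ≤ σ}

namespace BumpSum

variable {K : ℕ} {c : Fin K → ℂ} {ω : Fin K → ℝ} {p T : ℝ → ℂ} {σ μ e₁ e₂ e : ℝ}

lemma norm_sum_le (H : BumpSum c ω p T σ μ e₁ e₂ e) {θ : ℝ} (hθ : θ ∈ Icc 0 Real.pi)
    (s : Finset (Fin K)) (hs : ∀ l ∈ s, σ < |θ - ω l|) :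
    ‖∑ l ∈ s, c l * p (θ - ω l)‖ ≤ (∑ l, ‖c l‖) * e₂ := by
  calc ‖∑ l ∈ s, c l * p (θ - ω l)‖ ≤ ∑ l ∈ s, ‖c l‖ * e₂ := by
        refine norm_sum_le_of_le _ fun l hl => ?_
        rw [norm_mul]
        refine mul_le_mul_of_nonneg_left (H.decay _ (hs l hl) ?_) (norm_nonneg _)
        have := H.mem l
        rw [abs_le]
        constructor <;> linarith [hθ.1, hθ.2, this.1, this.2]
    _ ≤ ∑ l, ‖c l‖ * e₂ := Finset.sum_le_sum_of_subset_of_nonneg (Finset.subset_univ _)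
        fun _ _ _ => mul_nonneg (norm_nonneg _) H.e₂_nonneg
    _ = _ := (Finset.sum_mul _ _ _).symm

lemma norm_le_of_far (H : BumpSum c ω p T σ μ e₁ e₂ e) {θ : ℝ} (hθ : θ ∈ Icc 0 Real.pi)
    (hfar : ∀ l, σ < |θ - ω l|) : ‖T θ‖ ≤ e := by
  have h1 := H.norm_sum_le hθ Finset.univ fun l _ => hfar l
  have h2 := norm_le_norm_sub_add (T θ) (∑ l, c l * p (θ - ω l))
  linarith [H.approx θ, H.err]

/-- Within `σ` of one centre, every other centre is at least `7σ` away, so only tails of the other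
bumps remain. -/
lemma norm_sub_le (H : BumpSum c ω p T σ μ e₁ e₂ e) {θ : ℝ} (hθ : θ ∈ Icc 0 Real.pi) {l : Fin K}
    (hl : |θ - ω l| ≤ σ) : ‖T θ - c l * p (θ - ω l)‖ ≤ e := by
  classical
  have h1 := H.norm_sum_le hθ (Finset.univ.erase l) fun j hj => by
    have h := H.sep l j (Finset.ne_of_mem_erase hj).symm
    have h3 := abs_sub_le (ω l) θ (ω j)
    rw [abs_sub_comm (ω l) θ] at h3
    linarith [H.sigma_pos]
  have e3 : T θ - c l * p (θ - ω l) = (T θ - ∑ l, c l * p (θ - ω l)) +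
      ∑ j ∈ Finset.univ.erase l, c j * p (θ - ω j) := by
    rw [← Finset.add_sum_erase _ _ (Finset.mem_univ l)]
    ring
  rw [e3]
  linarith [norm_add_le (T θ - ∑ l, c l * p (θ - ω l))
    (∑ j ∈ Finset.univ.erase l, c j * p (θ - ω j)), H.approx θ, H.err]

lemma le_norm_center (H : BumpSum c ω p T σ μ e₁ e₂ e) (l : Fin K) : ‖c l‖ - e ≤ ‖T (ω l)‖ := by
  have h := H.norm_sub_le (H.mem l) (l := l) (by simpa using H.sigma_pos.le)
  rw [sub_self, H.one, mul_one, norm_sub_rev] at h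
  linarith [norm_sub_norm_le (c l) (T (ω l))]

lemma center_mem_cluster (H : BumpSum c ω p T σ μ e₁ e₂ e) (l : Fin K) :
    ω l ∈ cluster T μ σ (ω l) :=
  ⟨H.mem l, by linarith [H.le_norm_center l, H.amp l, H.err_le, H.pos],
    by simpa using H.sigma_pos.le⟩

lemma setOf_eq_iUnion_cluster (H : BumpSum c ω p T σ μ e₁ e₂ e) :
    {θ : ℝ | θ ∈ Icc 0 Real.pi ∧ μ / 2 ≤ ‖T θ‖} = ⋃ l, cluster T μ σ (ω l) := by
  ext θ
  simp only [mem_ofPred_eq, mem_iUnion, cluster]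
  constructor
  · rintro ⟨h1, h2⟩
    by_contra hne
    have := H.norm_le_of_far h1 fun l => by
      by_contra hl
      exact hne ⟨l, h1, h2, not_lt.1 hl⟩
    -- Far from all centres `‖T θ‖ ≤ e ≤ μ/4 < μ/2`.
    linarith [H.err_le, H.pos]
  · rintro ⟨l, h1, h2, -⟩
    exact ⟨h1, h2⟩

lemma le_abs_sub (H : BumpSum c ω p T σ μ e₁ e₂ e) {l j : Fin K} (hlj : l ≠ j) {θ θ' : ℝ}
    (hθ : θ ∈ cluster T μ σ (ω l)) (hθ' : θ' ∈ cluster T μ σ (ω j)) : 2 * σ ≤ |θ - θ'| := by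
  have h := H.sep l j hlj
  have h1 := abs_sub_le (ω l) θ (ω j)
  have h2 := abs_sub_le θ θ' (ω j)
  rw [abs_sub_comm (ω l) θ] at h1
  linarith [H.sigma_pos, hθ.2.2, hθ'.2.2]

lemma disjoint (H : BumpSum c ω p T σ μ e₁ e₂ e) {l j : Fin K} (hlj : l ≠ j) :
    Disjoint (cluster T μ σ (ω l)) (cluster T μ σ (ω j)) := by
  rw [Set.disjoint_left]
  intro θ h h'
  have := H.le_abs_sub hlj h h'
  rw [sub_self, abs_zero] at this
  linarith [H.sigma_pos]

lemma center_mem_cluster_iff (H : BumpSum c ω p T σ μ e₁ e₂ e) (l j : Fin K) :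
    ω j ∈ cluster T μ σ (ω l) ↔ j = l := by
  constructor
  · intro h
    by_contra hne
    exact Set.disjoint_left.1 (H.disjoint hne) (H.center_mem_cluster j) h
  · rintro rfl
    exact H.center_mem_cluster j

lemma diam_cluster_le (H : BumpSum c ω p T σ μ e₁ e₂ e) (l : Fin K) :
    Metric.diam (cluster T μ σ (ω l)) ≤ 2 * σ := by
  refine Metric.diam_le_of_forall_dist_le (by linarith [H.sigma_pos]) fun θ h θ' h' => ?_
  have := abs_sub_le θ (ω l) θ'
  rw [abs_sub_comm (ω l) θ'] at this
  rw [Real.dist_eq]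
  linarith [h.2.2, h'.2.2]

lemma exists_isMaxOn (H : BumpSum c ω p T σ μ e₁ e₂ e) (l : Fin K) :
    ∃ w ∈ cluster T μ σ (ω l), IsMaxOn (fun θ => ‖T θ‖) (cluster T μ σ (ω l)) w := by
  have hcl : IsClosed {θ : ℝ | μ / 2 ≤ ‖T θ‖ ∧ |θ - ω l| ≤ σ} :=
    (isClosed_le continuous_const H.continuous.norm).inter
      (isClosed_le (continuous_id.sub continuous_const).abs continuous_const)
  exact (isCompact_Icc.inter_right hcl).exists_isMaxOn ⟨_, H.center_mem_cluster l⟩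
    H.continuous.norm.continuousOn

lemma le_norm_of_isMaxOn (H : BumpSum c ω p T σ μ e₁ e₂ e) {l : Fin K} {w : ℝ}
    (hmax : IsMaxOn (fun θ => ‖T θ‖) (cluster T μ σ (ω l)) w) : ‖c l‖ - e ≤ ‖T w‖ :=
  (H.le_norm_center l).trans (hmax (H.center_mem_cluster l))

/-- At a maximizer the bump around `ω l` almost has its maximal size. -/
lemma norm_mul_ge_of_isMaxOn (H : BumpSum c ω p T σ μ e₁ e₂ e) {l : Fin K} {w : ℝ}
    (hw : w ∈ cluster T μ σ (ω l)) (hmax : IsMaxOn (fun θ => ‖T θ‖) (cluster T μ σ (ω l)) w) :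
    ‖c l‖ - 2 * e ≤ ‖c l‖ * ‖p (w - ω l)‖ := by
  have h1 := H.norm_sub_le hw.1 hw.2.2
  rw [← norm_mul]
  linarith [H.le_norm_of_isMaxOn hmax, norm_sub_norm_le (T w) (c l * p (w - ω l))]

/-- Follows from `2e ≤ μ/2 ≤ ‖c l‖/2`. Together with the decay of the kernel this locates the
maximizer. -/
lemma half_le_of_isMaxOn (H : BumpSum c ω p T σ μ e₁ e₂ e) {l : Fin K} {w : ℝ}
    (hw : w ∈ cluster T μ σ (ω l)) (hmax : IsMaxOn (fun θ => ‖T θ‖) (cluster T μ σ (ω l)) w) :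
    1 / 2 ≤ ‖p (w - ω l)‖ := by
  have h1 := H.norm_mul_ge_of_isMaxOn hw hmax
  have h2 := H.amp l
  have h3 := H.err_le
  have h4 : 0 < ‖c l‖ := H.pos.trans_le h2
  have h5 : ‖c l‖ * (1 / 2) ≤ ‖c l‖ * ‖p (w - ω l)‖ := by linarith
  exact le_of_mul_le_mul_left h5 h4

lemma abs_norm_sub_le_of_isMaxOn (H : BumpSum c ω p T σ μ e₁ e₂ e) {l : Fin K} {w : ℝ}
    (hw : w ∈ cluster T μ σ (ω l)) (hmax : IsMaxOn (fun θ => ‖T θ‖) (cluster T μ σ (ω l)) w) :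
    |‖T w‖ - ‖c l‖| ≤ e := by
  have h1 := H.norm_sub_le hw.1 hw.2.2
  have h2 := norm_sub_norm_le (T w) (c l * p (w - ω l))
  rw [norm_mul] at h2
  have h3 := mul_le_of_le_one_right (norm_nonneg (c l)) (H.le_one (w - ω l))
  rw [abs_le]
  constructor <;> linarith [H.le_norm_of_isMaxOn hmax]

/-- A real bump value `0 ≤ q ≤ 1` rotates no phase: the loss `‖c l‖(1 - q)` is a pure modulus loss,
at most `2e` at a maximizer. -/
lemma norm_sub_le_of_isMaxOn (H : BumpSum c ω p T σ μ e₁ e₂ e) {l : Fin K} {w : ℝ}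
    (hw : w ∈ cluster T μ σ (ω l)) (hmax : IsMaxOn (fun θ => ‖T θ‖) (cluster T μ σ (ω l)) w)
    {q : ℝ} (hq : 0 ≤ q) (hpq : p (w - ω l) = q) : ‖T w - c l‖ ≤ 3 * e := by
  have h1 := H.norm_sub_le hw.1 hw.2.2
  have h2 := H.norm_mul_ge_of_isMaxOn hw hmax
  have h3 := H.le_one (w - ω l)
  rw [hpq] at h1 h2 h3
  rw [Complex.norm_real, Real.norm_of_nonneg hq] at h2 h3
  have h4 : ‖c l * q - c l‖ = ‖c l‖ - ‖c l‖ * q := by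
    rw [show c l * q - c l = c l * ((q - 1 : ℝ) : ℂ) by push_cast; ring, norm_mul,
      Complex.norm_real, Real.norm_of_nonpos (by linarith)]
    ring
  linarith [norm_sub_le_norm_sub_add_norm_sub (T w) (c l * q) (c l)]

end BumpSum

/-- For small `α` the operator applied to a small perturbation of the signal is a perturbed sum of
bumps. -/
lemma bumpSum_sso {h : ℝ → ℝ} (hh : IsAdmissibleWindow h) {K : ℕ} {A : Fin K → ℝ → ℂ}
    {φ : Fin K → ℝ → ℝ} {t α : ℝ} (hα : 0 < α) (hcl : InClass A φ t α) {M μ B η V D δ : ℝ} {n : ℕ}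
    (hM : totalAmp A t = M) (hμ : minAmp A t = μ) (hB : maxFreq φ t = B)
    (hφ : ∀ j, 0 < deriv (φ j) t) (hη : freqGap φ t = 4 * B * η)
    (hμ0 : 0 < μ) (hB0 : 0 < B) (hη0 : 0 < η)
    (hδ : 0 < δ) (hδB : δ ≤ 1 / (4 * B)) (hn : 0 < n)
    (hnle : 1 ≤ n * (α * δ * √(8 * Real.pi * B)))
    (hnlt : ∀ j : ℤ, |j| < n → |(j : ℝ)| * (α * δ * √(8 * Real.pi * B)) ≤ 1)
    (hpos : 0 < hbar h n)
    (hker : ∀ u : ℝ, |u| ≤ Real.pi → ‖kernelPhi h n u‖ * (n * u) ^ 2 ≤ D * hbar h n)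
    (hα1 : 2 * α ≤ √(8 * Real.pi * B))
    (hα2 : α * (4 * D * (8 * Real.pi * B)) ≤ (B * η) ^ 2)
    (hα3 : 4 * ((2 * M + V) * α) ≤ μ)
    {g : ℝ → ℂ} (hg : ∀ u, ‖g u - signal A φ u‖ ≤ V * α) :
    BumpSum (fun l => A l t * Complex.exp (Complex.I * (φ l t : ℂ)))
      (fun l => δ * deriv (φ l) t) (fun u => kernelPhi h n u / hbar h n) (sso h n δ g t)
      (B * η * δ / 2) μ (M * α + V * α) α ((2 * M + V) * α) where
  continuous := hh.continuous_sso hn δ t g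
  one := by
    have : (hbar h n : ℂ) ≠ 0 := by exact_mod_cast hpos.ne'
    rw [kernelPhi_zero, div_self this]
  le_one u := by
    rw [norm_div, Complex.norm_real, Real.norm_of_nonneg hpos.le]
    exact div_le_one_of_le₀ (hh.norm_kernelPhi_le hn u) hpos.le
  approx θ := by
    rw [← hh.sso_exponential_sum hn δ t θ]
    refine hh.norm_sso_sub_le hn hpos fun j hj => ?_
    have h1 := hg (t - j * δ)
    have hv : |(-(j * δ) : ℝ)| ≤ α⁻¹ * (√(8 * Real.pi * maxFreq φ t))⁻¹ := by
      rw [hB, abs_neg, abs_mul, abs_of_pos hδ, ← mul_inv, ← one_div,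
        le_div_iff₀ (by positivity)]
      linarith [hnlt j hj]
    have h2 := hcl.norm_signal_sub_le hα (by rwa [hB]) (by rwa [hB]) hv
    rw [hM, ← sub_eq_add_neg] at h2
    linarith [norm_sub_le_norm_sub_add_norm_sub (g (t - j * δ)) (signal A φ (t - j * δ))
      (∑ l, A l t * Complex.exp (Complex.I * (φ l t : ℂ)) *
        Complex.exp (Complex.I * ((t - j * δ - t) * deriv (φ l) t : ℝ)))]
  decay u hu hu' := by
    have hs : √(8 * Real.pi * B) ^ 2 = 8 * Real.pi * B := Real.sq_sqrt (by positivity)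
    have h1 := hker u hu'
    rw [norm_div, Complex.norm_real, Real.norm_of_nonneg hpos.le, div_le_iff₀ hpos]
    set q := √(8 * Real.pi * B) with hq
    have hq0 : 0 < q := Real.sqrt_pos.2 (by positivity)
    -- `n ≥ 1/(αδq)` cancels the `δ` in the radius, so the smallness condition on `α` is free of
    -- `δ`.
    have h2 : B * η / 2 ≤ n * |u| * (α * q) := by
      have : B * η * δ / 2 * 1 ≤ |u| * (n * (α * δ * q)) := by gcongr
      have h3 : δ * (B * η / 2) ≤ δ * (n * |u| * (α * q)) := by linarith
      exact le_of_mul_le_mul_left h3 hδ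
    have h3 : (B * η / 2) ^ 2 ≤ (n * u) ^ 2 * (α ^ 2 * q ^ 2) := by
      calc (B * η / 2) ^ 2 ≤ (n * |u| * (α * q)) ^ 2 := by gcongr
        _ = (n * u) ^ 2 * (α ^ 2 * q ^ 2) := by rw [mul_pow, mul_pow, sq_abs]; ring
    rw [hs] at h3
    have h4 : ‖kernelPhi h n u‖ * (B * η / 2) ^ 2 ≤ D * hbar h n * (α ^ 2 * (8 * Real.pi * B)) := by
      calc _ ≤ ‖kernelPhi h n u‖ * ((n * u) ^ 2 * (α ^ 2 * (8 * Real.pi * B))) := by gcongr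
        _ = ‖kernelPhi h n u‖ * (n * u) ^ 2 * (α ^ 2 * (8 * Real.pi * B)) := by ring
        _ ≤ _ := by gcongr
    have h5 : D * hbar h n * (α ^ 2 * (8 * Real.pi * B)) ≤ α * hbar h n * (B * η / 2) ^ 2 := by
      calc D * hbar h n * (α ^ 2 * (8 * Real.pi * B))
          = α * hbar h n / 4 * (α * (4 * D * (8 * Real.pi * B))) := by ring
        _ ≤ α * hbar h n / 4 * (B * η) ^ 2 := by gcongr
        _ = _ := by ring
    exact le_of_mul_le_mul_right (h4.trans h5) (by positivity)
  amp l := by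
    rw [norm_mul, Complex.norm_exp_I_mul_ofReal, mul_one, ← hμ]
    exact minAmp_le A t l
  err := by
    simp only [norm_mul, Complex.norm_exp_I_mul_ofReal, mul_one]
    rw [← totalAmp, hM]
    linarith
  err_le := hα3
  pos := hμ0
  sigma_pos := by positivity
  e₂_nonneg := hα.le
  mem l := by
    have h1 := abs_deriv_le_maxFreq φ t l
    rw [hB, abs_of_pos (hφ l)] at h1
    have h2 : δ * deriv (φ l) t ≤ 1 / (4 * B) * B := by
      have := hφ l
      gcongr
    have h3 : 1 / (4 * B) * B = 1 / 4 := by field_simp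
    exact ⟨(mul_pos hδ (hφ l)).le, by linarith [Real.pi_gt_three]⟩
  sep l j hlj := by
    have h1 := freqGap_le φ t hlj
    rw [hη] at h1
    rw [← mul_sub, abs_mul, abs_of_pos hδ]
    -- The radius `σ = Bηδ/2` makes `8σ` exactly the frequency gap times `δ`, and `2σ` the diameter
    -- bound in (a).
    calc 8 * (B * η * δ / 2) = δ * (4 * B * η) := by ring
      _ ≤ _ := by gcongr

end SSO

/-! ### The main theorem: choice of constants and assembly -/

theorem theorem3p1 :
    ∀ m : ℕ, 1 ≤ m → ∃ c : ℝ, 0 < c ∧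
    ∀ ρ : ℝ, 1 ≤ ρ → ∃ C : ℝ, 0 < C ∧
    ∀ h : ℝ → ℝ, SSO.IsAdmissibleWindow h →
    ∀ E M μ B η : ℝ, 0 < E → 0 < M → 0 < μ → 0 < B → 0 < η →
    ∃ α₀ : ℝ, 0 < α₀ ∧ ∃ γ : ℝ, 0 < γ ∧
    -- the signal, with its parameters at the time `t`
    ∀ (K : ℕ) (A : Fin K → ℝ → ℂ) (φ : Fin K → ℝ → ℝ) (t α : ℝ), 0 < K →
      0 < α → α ≤ α₀ → SSO.InClass A φ t α →
      SSO.totalAmp A t = M → SSO.minAmp A t = μ → SSO.maxFreq φ t = B →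
      (∀ j, 0 < deriv (φ j) t) → SSO.freqGap φ t = 4 * B * η →
    -- the nodes
    ∀ (a b : ℝ) (L r : ℕ) (x : ℕ → ℝ), 1 ≤ L → r < m →
      SSO.IsNodeSeq a b (L * m + r) x → SSO.MeshRatioLe ρ (L * m + r) x →
    -- smoothness and support of the signal
      ContDiffOn ℝ m (SSO.signal A φ) (Icc a b) →
      (∀ u, u ∉ Icc a b → SSO.signal A φ u = 0) →
    -- the noise and the sampled function `F`
    ∀ ε F : ℝ → ℂ, (∀ u, F u = SSO.signal A φ u + ε u) →
      (∀ u : ℝ, c * SSO.meshNorm (L * m + r) x ^ m * SSO.maxDeriv m a b (SSO.signal A φ)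
        + ‖ε u‖ ≤ E * α) →
    -- the parameters of the operator; `T θ` is its value at `(t, θ)` for `Q(F)`
    ∀ (δ : ℝ) (n : ℕ) (T : ℝ → ℂ), 0 < δ → δ ≤ 1 / (4 * B) →
      IsLeast {k : ℕ | (α * δ * √(8 * Real.pi * B))⁻¹ ≤ (k : ℝ)} n →
      (∀ θ, T θ = SSO.sso h n δ (SSO.interpQ m L r x F) t θ) →
    0 < SSO.hbar h n ∧
    ∃ G : Fin K → Set ℝ,
      -- (a)
      {θ : ℝ | θ ∈ Icc 0 Real.pi ∧ μ / 2 ≤ ‖T θ‖} = ⋃ l, G l ∧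
      (∀ l, (G l).Nonempty) ∧
      (∀ l j, l ≠ j → Disjoint (G l) (G j)) ∧
      (∀ l j, δ * deriv (φ j) t ∈ G l ↔ j = l) ∧
      (∀ l, Metric.diam (G l) ≤ B * η * δ) ∧
      (∀ l j, l ≠ j → ∀ θ ∈ G l, ∀ θ' ∈ G j, B * η * δ ≤ |θ - θ'|) ∧
      -- the maximum of `|T|` over each cluster is attained
      (∀ l, ∃ ω ∈ G l, IsMaxOn (fun θ => ‖T θ‖) (G l) ω) ∧
      (∀ l, ∀ ω ∈ G l, IsMaxOn (fun θ => ‖T θ‖) (G l) ω →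
        -- (b)
        |ω - δ * deriv (φ l) t| ≤ γ * α * δ ∧
        -- (c)
        ((∀ u : ℝ, (SSO.kernelPhi h n u).im = 0 ∧ 0 ≤ (SSO.kernelPhi h n u).re) →
          |‖T ω‖ - ‖A l t‖| ≤ 2 * (2 * M + C * E) * α ∧
          ‖T ω - A l t * Complex.exp (Complex.I * (φ l t : ℂ))‖
            ≤ 2 * (1 + 5 * M / μ) * (2 * M + C * E) * α)) := by
  intro m hm
  refine ⟨1, one_pos, fun ρ hρ => ?_⟩
  have hm0 : (0 : ℝ) < m := by exact_mod_cast hm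
  have hρ0 : 0 < ρ := zero_lt_one.trans_le hρ
  obtain ⟨C, hC, hC0⟩ : ∃ C : ℝ, C = (2 * m) ^ m * (m * (2 * m * ρ ^ (4 * m)) ^ m + 1) ∧ 0 < C :=
    ⟨_, rfl, by positivity⟩
  refine ⟨C, hC0, fun h hh E M μ B η hE hM hμ hB hη => ?_⟩
  obtain ⟨D, hD, n₀, hker⟩ := hh.exists_norm_kernelPhi_le
  set q := √(8 * Real.pi * B) with hq
  have hq0 : 0 < q := Real.sqrt_pos.2 (by positivity)
  -- The four bounds on `α` serve, in order: freezing the signal, `n ≥ n₀`, bump tails at most `α`,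
  -- and `4e ≤ μ`. The value of `γ` comes from `n|u| ≤ √(2D)` at a maximizer.
  refine ⟨min (min (q / 2) (4 * B / (q * (n₀ + 1))))
    (min ((B * η) ^ 2 / (4 * D * (8 * Real.pi * B))) (μ / (4 * (2 * M + C * E)))),
    by positivity, √(2 * D) * q, by positivity, ?_⟩
  intro K A φ t α _ hα hα0 hcl hM' hμ' hB' hφ hη' a b L r x hL hr hx hmesh hf hf0 ε F hF hFE
    δ n T hδ hδB hnl hT
  obtain ⟨⟨hα1, hα2⟩, hα3, hα4⟩ : (α ≤ _ ∧ α ≤ _) ∧ α ≤ _ ∧ α ≤ _ := by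
    simpa only [le_min_iff] using hα0
  rw [le_div_iff₀ (by positivity)] at hα1 hα2 hα3 hα4
  have hs : 0 < α * δ * q := by positivity
  have hn1 : (α * δ * q)⁻¹ ≤ n := hnl.1
  have hn : 0 < n := by
    have : (0 : ℝ) < n := (inv_pos.2 hs).trans_le hn1
    exact_mod_cast this
  have hnle : 1 ≤ n * (α * δ * q) := by
    rwa [inv_le_iff_one_le_mul₀ hs] at hn1
  -- Otherwise `|j|` would be a smaller admissible value of `n`.
  have hnlt : ∀ j : ℤ, |j| < n → |(j : ℝ)| * (α * δ * q) ≤ 1 := by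
    intro j hj
    by_contra! hlt
    have h1 : j.natAbs ∈ {k : ℕ | (α * δ * q)⁻¹ ≤ (k : ℝ)} := by
      rw [Set.mem_ofPred_eq, inv_le_iff_one_le_mul₀ hs, Nat.cast_natAbs, Int.cast_abs]
      exact hlt.le
    have h2 := hnl.2 h1
    rw [Int.abs_eq_natAbs] at hj
    omega
  have hnn₀ : n₀ ≤ n := by
    have h1 : δ * (4 * B) ≤ 1 := by rwa [le_div_iff₀ (by positivity)] at hδB
    have h2 : δ * (α * (q * (n₀ + 1))) ≤ δ * (4 * B) := by gcongr
    have h3 : (n₀ : ℝ) * (α * δ * q) ≤ n * (α * δ * q) := by nlinarith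
    exact_mod_cast le_of_mul_le_mul_right h3 hs
  obtain ⟨hpos, hdecay⟩ := hker n hnn₀ hn
  have hg : ∀ u, ‖SSO.interpQ m L r x F u - SSO.signal A φ u‖ ≤ C * E * α := by
    intro u
    have := SSO.norm_interpQ_sub_le hm hρ hL hr hx hmesh hf hf0 (F := F) (ν := E * α)
      (fun u => by have := hFE u; rw [hF u, add_sub_cancel_left]; rwa [one_mul] at this) u
    rwa [← hC, ← mul_assoc] at this
  have H := SSO.bumpSum_sso hh hα hcl hM' hμ' hB' hφ hη' hμ hB hη hδ hδB hn hnle hnlt hpos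
    hdecay (by linarith) hα3 (by linarith) hg
  obtain rfl : T = SSO.sso h n δ (SSO.interpQ m L r x F) t := funext hT
  have h2σ : 2 * (B * η * δ / 2) = B * η * δ := by ring
  have he0 : 0 < (2 * M + C * E) * α := by positivity
  have hnorm : ∀ l, ‖A l t * Complex.exp (Complex.I * (φ l t : ℂ))‖ = ‖A l t‖ := fun l => by
    rw [norm_mul, Complex.norm_exp_I_mul_ofReal, mul_one]
  refine ⟨hpos, fun l => SSO.cluster (SSO.sso h n δ (SSO.interpQ m L r x F) t) μ (B * η * δ / 2)
    (δ * deriv (φ l) t), H.setOf_eq_iUnion_cluster, fun l => ⟨_, H.center_mem_cluster l⟩,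
    fun l j hlj => H.disjoint hlj, H.center_mem_cluster_iff,
    fun l => (H.diam_cluster_le l).trans h2σ.le,
    fun l j hlj θ hθ θ' hθ' => h2σ.ge.trans (H.le_abs_sub hlj hθ hθ'), H.exists_isMaxOn,
    fun l w hw hmax => ⟨?_, fun hreal => ⟨?_, ?_⟩⟩⟩
  · have hw1 : |w - δ * deriv (φ l) t| ≤ Real.pi := by
      have h1 := H.mem l
      rw [abs_le]
      constructor <;> linarith [hw.1.1, hw.1.2, h1.1, h1.2]
    have h1 := hdecay _ hw1
    have h2 := H.half_le_of_isMaxOn hw hmax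
    set u := w - δ * deriv (φ l) t with hu
    rw [norm_div, Complex.norm_real, Real.norm_of_nonneg hpos.le, le_div_iff₀ hpos] at h2
    -- A bump value of at least `1/2` against the decay `D/(nu)²`.
    have h3 : (n * u) ^ 2 ≤ 2 * D := by
      have : SSO.hbar h n * (n * u) ^ 2 ≤ SSO.hbar h n * (2 * D) := by
        nlinarith [mul_le_mul_of_nonneg_right h2 (sq_nonneg (n * u))]
      exact le_of_mul_le_mul_left this hpos
    have h4 : n * |u| ≤ √(2 * D) := by
      have := Real.abs_le_sqrt h3
      rwa [abs_mul, Nat.abs_cast] at this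
    calc |u| = |u| * 1 := (mul_one _).symm
      _ ≤ |u| * (n * (α * δ * q)) := by gcongr
      _ = n * |u| * (α * δ * q) := by ring
      _ ≤ √(2 * D) * (α * δ * q) := by gcongr
      _ = √(2 * D) * q * α * δ := by ring
  · have h1 := H.abs_norm_sub_le_of_isMaxOn hw hmax
    rw [hnorm] at h1
    linarith
  · obtain ⟨him, hre⟩ := hreal (w - δ * deriv (φ l) t)
    refine (H.norm_sub_le_of_isMaxOn hw hmax (q := (SSO.kernelPhi h n (w - δ * deriv (φ l) t)).re /
      SSO.hbar h n) (div_nonneg hre hpos.le) ?_).trans ?_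
    · rw [Complex.ofReal_div]
      congr 1
      exact Complex.ext rfl (by simpa using him)
    · have h1 : 0 ≤ M / μ * ((2 * M + C * E) * α) := by positivity
      have h2 : μ ≤ M := by
        rw [← hM', ← hμ']
        exact (SSO.minAmp_le A t l).trans (SSO.norm_le_totalAmp A t l)
      -- Since `M/μ ≥ 1`, the error `3e` fits into `2e + 10(M/μ)e`.
      have h3 : 1 * ((2 * M + C * E) * α) ≤ M / μ * ((2 * M + C * E) * α) := by
        gcongr
        rwa [one_le_div hμ]
      have h4 : 2 * (1 + 5 * M / μ) * (2 * M + C * E) * α = 2 * ((2 * M + C * E) * α) +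
          10 * (M / μ * ((2 * M + C * E) * α)) := by ring
      linarith
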